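/- Let $n,m\ge 1$ be integers, $0<\alpha<n$, $0<\beta<m$, $1<p<\infty$ and $\vartheta>1$. For a measurable function $f:\mathbb R^n\times\mathbb R^m\to\mathbb C$ put $$I_{\alpha\beta}f(x,y)=\iint_{\mathbb R^n\times\mathbb R^m} f(u,v)\,\Big(\frac1{|x-u|}\Big)^{n-\alpha}\Big(\frac1{|y-v|}\Big)^{m-\beta}\,du\,dv .$$ For measurable weights $\omega,\sigma:\mathbb R^n\times\mathbb R^m\to[0,\infty]$ put $$A^{\alpha\beta}_{p\vartheta}(\omega,\sigma)=\sup_{Q\times P}\ |Q|^{\frac{\alpha}{n}-\frac1\vartheta}\,|P|^{\frac{\beta}{m}-\frac1\vartheta}\Big\{\iint_{Q\times P}\omega^{p\vartheta}(x,y)\,dx\,dy\Big\}^{\frac1{p\vartheta}}\Big\{\iint_{Q\times P}\Big(\frac1\sigma\Big)^{\frac{p\vartheta}{p-1}}(x,y)\,dx\,dy\Big\}^{\frac{p-1}{p\vartheta}},$$ the supremum being taken over all cubes $Q\subset\mathbb R^n$ and $P\subset\mathbb R^m$ with sides parallel to the coordinate axes (with the conventions $1/0=\infty$, $1/\infty=0$,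 $0\cdot\infty=0$). Then there is a constant $C>0$, depending only on $p,\vartheta,\alpha,\beta,n,m$, such that for all weights $\omega,\sigma$ with $A^{\alpha\beta}_{p\vartheta}(\omega,\sigma)<\infty$ and all measurable $f$ with $\|f\sigma\|_{L^p(\mathbb R^n\times\mathbb R^m)}<\infty$, the integral defining $I_{\alpha\beta}f(x,y)$ converges absolutely for almost every $(x,y)$ with $\omega(x,y)\neq0$, and $$\|\omega\, I_{\alpha\beta}f\|_{L^p(\mathbb R^n\times\mathbb R^m)}\le C\,A^{\alpha\beta}_{p\vartheta}(\omega,\sigma)\,\|f\sigma\|_{L^p(\mathbb R^n\times\mathbb R^m)} .$$ -/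

import Mathlib

open MeasureTheory
open scoped ENNReal

noncomputable section

/-- The kernel `(1/|x-u|)^{n-α} (1/|y-v|)^{m-β}` on `ℝⁿ × ℝᵐ`, with Euclidean norms in both
factors. (On the null set where `x = u` or `y = v` its value is irrelevant.) -/
def strongKernel {n m : ℕ} (α β : ℝ)
    (z w : EuclideanSpace ℝ (Fin n) × EuclideanSpace ℝ (Fin m)) : ℝ :=
  (1 / ‖z.1 - w.1‖) ^ ((n : ℝ) - α) * (1 / ‖z.2 - w.2‖) ^ ((m : ℝ) - β)

/-- The integrand `(u,v) ↦ f(u,v) (1/|x-u|)^{n-α} (1/|y-v|)^{m-β}` at the point `z = (x,y)`. -/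
def strongFracIntegrand {n m : ℕ} (α β : ℝ)
    (f : EuclideanSpace ℝ (Fin n) × EuclideanSpace ℝ (Fin m) → ℂ)
    (z w : EuclideanSpace ℝ (Fin n) × EuclideanSpace ℝ (Fin m)) : ℂ :=
  f w * ((strongKernel α β z w : ℝ) : ℂ)

/-- The strong fractional integral `I_{αβ} f` on `ℝⁿ × ℝᵐ`. -/
def strongFracIntegral {n m : ℕ} (α β : ℝ)
    (f : EuclideanSpace ℝ (Fin n) × EuclideanSpace ℝ (Fin m) → ℂ)
    (z : EuclideanSpace ℝ (Fin n) × EuclideanSpace ℝ (Fin m)) : ℂ :=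
  ∫ w, strongFracIntegrand α β f z w

/-- The closed cube in `ℝⁿ` with sides parallel to the axes, lower corner `a`, side length `s`. -/
def cube {n : ℕ} (a : EuclideanSpace ℝ (Fin n)) (s : ℝ) : Set (EuclideanSpace ℝ (Fin n)) :=
  {x | ∀ i, a i ≤ x i ∧ x i ≤ a i + s}

/-- The quantity attached to one product set `Q × P` in the two-weight `ϑ`-bump characteristic. -/
def bumpQuantity {n m : ℕ} (α β p ϑ : ℝ)
    (ω σ : EuclideanSpace ℝ (Fin n) × EuclideanSpace ℝ (Fin m) → ℝ≥0∞)
    (Q : Set (EuclideanSpace ℝ (Fin n))) (P : Set (EuclideanSpace ℝ (Fin m))) : ℝ≥0∞ :=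
  volume Q ^ (α / n - 1 / ϑ) * volume P ^ (β / m - 1 / ϑ)
    * (∫⁻ z in Q ×ˢ P, ω z ^ (p * ϑ)) ^ (1 / (p * ϑ))
    * (∫⁻ z in Q ×ˢ P, (1 / σ z) ^ (p * ϑ / (p - 1))) ^ ((p - 1) / (p * ϑ))

/-- The two-weight `ϑ`-bump characteristic `A^{αβ}_{pϑ}(ω,σ)`: the supremum of `bumpQuantity`
over all products `Q × P` of cubes `Q ⊂ ℝⁿ`, `P ⊂ ℝᵐ` of positive side lengths. -/
def bumpChar {n m : ℕ} (α β p ϑ : ℝ)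
    (ω σ : EuclideanSpace ℝ (Fin n) × EuclideanSpace ℝ (Fin m) → ℝ≥0∞) : ℝ≥0∞ :=
  ⨆ (a : EuclideanSpace ℝ (Fin n)) (s : ℝ) (_ : 0 < s)
    (b : EuclideanSpace ℝ (Fin m)) (t : ℝ) (_ : 0 < t),
    bumpQuantity α β p ϑ ω σ (cube a s) (cube b t)

end

/-!
Two-weight `L^p` bound for the strong fractional integral under a two-parameter bump condition.

Discretise: on dyadic scales `(i, j)` the kernel is dominated by
`∑ 2^{-(n-α)i} 2^{-(m-β)j} 1_{Q × P}`, where `Q × P` is the box of dilated dyadic cubes of sides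
`3·2ⁱ`, `3·2ʲ` attached to the point (`lintegral_mul_strongKernel_le`). By duality the inequality
becomes an estimate of `∑_R |R| κ(R) ⟨F/σ⟩_R ⟨Gω⟩_R` over all boxes `R`, with
`κ(R) = 2^{αi + βj}`. Half of the bump and Hölder's inequality give
`⟨F/σ⟩_R ⟨Gω⟩_R ≤ ⟨σ^{-s}⟩_R^{1/s} ⟨ω^t⟩_R^{1/t} · M(F^a)^{1/a} M(G^b)^{1/b}` on `R`, with `M` the
strong maximal function, `a < p` and `b < p'`; so the two maximal terms are bounded on `L^p` and
`L^{p'}`. It remains to see that the coefficients `c_R = κ(R) ⟨σ^{-s}⟩_R^{1/s} ⟨ω^t⟩_R^{1/t}` of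
the boxes containing a point have a bounded sum. This may fail at some points, but the sum over
`R` of `|R| (...)` only needs, for each `R`, half of the points of `R`, and there it is true.

The point is the following. Let `R` and `R'` be two boxes at the same point `z` and `R ∨ R'` their
join, of scales `max i i'` and `max j j'`. The other half of the bump, with the `L^τ`
bounds for the strong and the one-variable maximal functions, shows that for `z` outside a small part of
`R` the average over `R'` of either weight is at most `C 2^{δ d}` times the bumped average over
`R ∨ R'`, `d` being the distance of the scales of `R` and `R ∨ R'`, provided `R'` is not larger
than `R` in both directions (`goodSet`, `exists_volume_diff_goodSet_le`). The bump condition for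
`R ∨ R'` then bounds `c_{R'}` with a gain of a power of the ratio of the sizes of `R'` and
`R ∨ R'` (`boxCoefficient_le`). If `z` is good for both boxes, multiplying the bounds for `c_R`
and `c_{R'}` gives `c_R c_{R'} ≤ (C A)² 2^{-δ dist(R, R')}`, where the distance is that of the
pairs of scales; if one box is larger than the other in both directions, only the smaller one
gains, which is enough. Comparing with a nearly largest coefficient, `∑_R c_R ≤ C' A`
(`exists_tsum_le_of_mul_le`, `exists_tsum_boxCoefficient_le`).

The maximal theorem for cubes is proved from the Vitali covering theorem and a sum over dyadic
levels (`exists_lintegral_cubeMaximal_rpow_le`), and iterated in the two variables for the strong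
maximal function.
-/

/-! ### Dyadic cells and dilated dyadic cubes -/

/-- The integer vector `k` such that `x` lies in the half-open dyadic cell
`∏ₗ [kₗ 2ⁱ, (kₗ + 1) 2ⁱ)`. -/
noncomputable def dyadicIndex {n : ℕ} (i : ℤ) (x : EuclideanSpace ℝ (Fin n)) : Fin n → ℤ :=
  fun l => ⌊x l / 2 ^ i⌋

/-- The half-open dyadic cell of side `2ⁱ` with index `k`. -/
def dyadicCell {n : ℕ} (i : ℤ) (k : Fin n → ℤ) : Set (EuclideanSpace ℝ (Fin n)) :=
  dyadicIndex i ⁻¹' {k}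

/-- The closed cube of side `3 · 2ⁱ` concentric with the dyadic cell of side `2ⁱ` and index `k`. -/
noncomputable def dilatedCube {n : ℕ} (i : ℤ) (k : Fin n → ℤ) : Set (EuclideanSpace ℝ (Fin n)) :=
  cube (WithLp.toLp 2 fun l => ((k l : ℝ) - 1) * 2 ^ i) (3 * 2 ^ i)

section Grid

variable {n : ℕ}

lemma mem_dilatedCube {i : ℤ} {k : Fin n → ℤ} {u : EuclideanSpace ℝ (Fin n)} :
    u ∈ dilatedCube i k ↔ ∀ l, ((k l : ℝ) - 1) * 2 ^ i ≤ u l ∧ u l ≤ (k l + 2) * 2 ^ i := by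
  simp only [dilatedCube, cube, Set.mem_ofPred_eq]
  refine forall_congr' fun l => ?_
  have : ((k l : ℝ) - 1) * 2 ^ i + 3 * 2 ^ i = (k l + 2) * 2 ^ i := by ring
  rw [this]

lemma mem_dyadicCell {i : ℤ} {k : Fin n → ℤ} {u : EuclideanSpace ℝ (Fin n)} :
    u ∈ dyadicCell i k ↔ ∀ l, (k l : ℝ) * 2 ^ i ≤ u l ∧ u l < (k l + 1) * 2 ^ i := by
  have h2 : (0 : ℝ) < 2 ^ i := by positivity
  simp only [dyadicCell, Set.mem_preimage, Set.mem_singleton_iff, funext_iff, dyadicIndex,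
    Int.floor_eq_iff, le_div_iff₀ h2, div_lt_iff₀ h2]

lemma measurable_dyadicIndex (i : ℤ) :
    Measurable (dyadicIndex i : EuclideanSpace ℝ (Fin n) → Fin n → ℤ) := by
  refine measurable_pi_lambda _ fun l => ?_
  exact Int.measurable_floor.comp (by fun_prop)

lemma measurableSet_dyadicCell (i : ℤ) (k : Fin n → ℤ) : MeasurableSet (dyadicCell i k) :=
  measurable_dyadicIndex i (measurableSet_singleton k)

lemma cube_eq_preimage (a : EuclideanSpace ℝ (Fin n)) (s : ℝ) :
    cube a s = (WithLp.ofLp : EuclideanSpace ℝ (Fin n) → _) ⁻¹'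
      (Set.pi Set.univ fun l => Set.Icc (a l) (a l + s)) := by
  ext; simp [cube, Pi.le_def, forall_and]

lemma measurableSet_cube (a : EuclideanSpace ℝ (Fin n)) (s : ℝ) : MeasurableSet (cube a s) := by
  rw [cube_eq_preimage]
  exact (PiLp.volume_preserving_ofLp (Fin n)).measurable
    (MeasurableSet.univ_pi fun _ => measurableSet_Icc)

lemma measurableSet_dilatedCube (i : ℤ) (k : Fin n → ℤ) : MeasurableSet (dilatedCube i k) :=
  measurableSet_cube _ _

lemma volume_cube (a : EuclideanSpace ℝ (Fin n)) (s : ℝ) :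
    volume (cube a s) = ENNReal.ofReal s ^ n := by
  have h := (PiLp.volume_preserving_ofLp (Fin n)).measure_preimage
    (s := Set.pi Set.univ fun l => Set.Icc (a l) (a l + s))
    (MeasurableSet.univ_pi fun _ => measurableSet_Icc).nullMeasurableSet
  rw [cube_eq_preimage, h, volume_pi_pi]
  simp

lemma ofReal_two_zpow (i : ℤ) : ENNReal.ofReal ((2 : ℝ) ^ i) = (2 : ℝ≥0∞) ^ (i : ℝ) := by
  rw [← Real.rpow_intCast, ← ENNReal.ofReal_rpow_of_pos (by norm_num)]
  simp

lemma volume_dyadicCell (i : ℤ) (k : Fin n → ℤ) :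
    volume (dyadicCell i k) = ((2 : ℝ≥0∞) ^ (i : ℝ)) ^ n := by
  have h := (PiLp.volume_preserving_ofLp (Fin n)).measure_preimage
    (s := Set.pi Set.univ fun l => Set.Ico ((k l : ℝ) * 2 ^ i) ((k l + 1) * 2 ^ i))
    (MeasurableSet.univ_pi fun _ => measurableSet_Ico).nullMeasurableSet
  have h' : dyadicCell i k = (WithLp.ofLp : EuclideanSpace ℝ (Fin n) → _) ⁻¹'
      (Set.pi Set.univ fun l => Set.Ico ((k l : ℝ) * 2 ^ i) ((k l + 1) * 2 ^ i)) := by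
    ext; simp [mem_dyadicCell]
  rw [h', h, volume_pi_pi]
  have : ∀ l, ((k l : ℝ) + 1) * 2 ^ i - k l * 2 ^ i = 2 ^ i := fun l => by ring
  simp [this, ofReal_two_zpow]

lemma volume_dilatedCube (i : ℤ) (k : Fin n → ℤ) :
    volume (dilatedCube i k) = (3 * (2 : ℝ≥0∞) ^ (i : ℝ)) ^ n := by
  rw [dilatedCube, volume_cube, ENNReal.ofReal_mul (by norm_num), ofReal_two_zpow]
  simp

lemma two_rpow_ne_zero (r : ℝ) : (2 : ℝ≥0∞) ^ r ≠ 0 := by simp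

lemma two_rpow_ne_top (r : ℝ) : (2 : ℝ≥0∞) ^ r ≠ ∞ := by
  simp

lemma volume_dyadicCell_ne_zero (i : ℤ) (k : Fin n → ℤ) : volume (dyadicCell i k) ≠ 0 := by
  rw [volume_dyadicCell]; exact pow_ne_zero _ (two_rpow_ne_zero _)

lemma volume_dyadicCell_ne_top (i : ℤ) (k : Fin n → ℤ) : volume (dyadicCell i k) ≠ ∞ := by
  rw [volume_dyadicCell]; exact ENNReal.pow_ne_top (two_rpow_ne_top _)

lemma volume_dilatedCube_eq (i : ℤ) (k : Fin n → ℤ) :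
    volume (dilatedCube i k) = 3 ^ n * volume (dyadicCell i k) := by
  rw [volume_dyadicCell, volume_dilatedCube, mul_pow]

lemma volume_dilatedCube_ne_zero (i : ℤ) (k : Fin n → ℤ) : volume (dilatedCube i k) ≠ 0 := by
  rw [volume_dilatedCube_eq]
  exact mul_ne_zero (by simp) (volume_dyadicCell_ne_zero i k)

lemma volume_dilatedCube_ne_top (i : ℤ) (k : Fin n → ℤ) : volume (dilatedCube i k) ≠ ∞ := by
  rw [volume_dilatedCube_eq]
  exact ENNReal.mul_ne_top (by simp) (volume_dyadicCell_ne_top i k)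

lemma dyadicCell_subset_dilatedCube (i : ℤ) (k : Fin n → ℤ) :
    dyadicCell i k ⊆ dilatedCube i k := by
  intro u hu
  rw [mem_dyadicCell] at hu
  rw [mem_dilatedCube]
  have h2 : (0 : ℝ) < 2 ^ i := by positivity
  exact fun l => ⟨by linarith [(hu l).1], by linarith [(hu l).2]⟩

lemma self_mem_dyadicCell (i : ℤ) (x : EuclideanSpace ℝ (Fin n)) :
    x ∈ dyadicCell i (dyadicIndex i x) := rfl

lemma two_zpow_mul_floor_le {i j : ℤ} (hij : i ≤ j) (t : ℝ) :
    (⌊t / 2 ^ j⌋ : ℝ) * 2 ^ j ≤ ⌊t / 2 ^ i⌋ * 2 ^ i ∧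
      ((⌊t / 2 ^ i⌋ : ℝ) + 1) * 2 ^ i ≤ (⌊t / 2 ^ j⌋ + 1) * 2 ^ j := by
  obtain ⟨d, rfl⟩ := Int.le.dest hij
  have hi : (0 : ℝ) < 2 ^ i := by positivity
  have hd : (0 : ℝ) < 2 ^ d := by positivity
  have h2 : (2 : ℝ) ^ (i + (d : ℤ)) = 2 ^ d * 2 ^ i := by
    rw [zpow_add₀ two_ne_zero, zpow_natCast, mul_comm]
  set K := ⌊t / 2 ^ (i + (d : ℤ))⌋ with hK
  have h1 : (K : ℝ) * (2 ^ d * 2 ^ i) ≤ t := by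
    rw [← h2, ← le_div_iff₀ (by positivity)]; exact Int.floor_le _
  have h3 : t < (K + 1 : ℝ) * (2 ^ d * 2 ^ i) := by
    rw [← h2, ← div_lt_iff₀ (by positivity)]; exact Int.lt_floor_add_one _
  have h4 : K * 2 ^ d ≤ ⌊t / 2 ^ i⌋ := by
    rw [Int.le_floor, le_div_iff₀ hi]; push_cast; linarith
  have h5 : ⌊t / 2 ^ i⌋ < (K + 1) * 2 ^ d := by
    rw [Int.floor_lt, div_lt_iff₀ hi]; push_cast; linarith
  have h4' : (K : ℝ) * 2 ^ d ≤ ⌊t / 2 ^ i⌋ := by exact_mod_cast h4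
  have h5' : (⌊t / 2 ^ i⌋ : ℝ) + 1 ≤ (K + 1) * 2 ^ d := by
    exact_mod_cast Int.add_one_le_iff.mpr h5
  rw [h2]
  constructor
  · rw [← mul_assoc]; gcongr
  · rw [← mul_assoc]; gcongr

lemma dilatedCube_mono {i j : ℤ} (hij : i ≤ j) (x : EuclideanSpace ℝ (Fin n)) :
    dilatedCube i (dyadicIndex i x) ⊆ dilatedCube j (dyadicIndex j x) := by
  intro u hu
  rw [mem_dilatedCube] at hu ⊢
  intro l
  have h := two_zpow_mul_floor_le hij (x l)
  have h2 : (2 : ℝ) ^ i ≤ 2 ^ j := zpow_le_zpow_right₀ (by norm_num) hij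
  have h3 := hu l
  simp only [dyadicIndex] at h3 ⊢
  constructor <;> nlinarith

/-- The index at a coarser scale is determined by the index at a finer scale. -/
lemma dyadicIndex_eq_of_le {i j : ℤ} (hij : i ≤ j) {x y : EuclideanSpace ℝ (Fin n)}
    (h : dyadicIndex i x = dyadicIndex i y) : dyadicIndex j x = dyadicIndex j y := by
  ext l
  have hl : ⌊x l / 2 ^ i⌋ = ⌊y l / 2 ^ i⌋ := congrFun h l
  have h1 := two_zpow_mul_floor_le hij (x l)
  have h2 := two_zpow_mul_floor_le hij (y l)
  rw [hl] at h1
  have hi : (0 : ℝ) < 2 ^ i := by positivity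
  have hj : (0 : ℝ) < 2 ^ j := by positivity
  have a1 : (⌊x l / 2 ^ j⌋ : ℝ) < ⌊y l / 2 ^ j⌋ + 1 := by
    refine lt_of_mul_lt_mul_right ?_ hj.le; nlinarith
  have a2 : (⌊y l / 2 ^ j⌋ : ℝ) < ⌊x l / 2 ^ j⌋ + 1 := by
    refine lt_of_mul_lt_mul_right ?_ hj.le; nlinarith
  have a3 : ⌊x l / 2 ^ j⌋ < ⌊y l / 2 ^ j⌋ + 1 := by exact_mod_cast a1
  have a4 : ⌊y l / 2 ^ j⌋ < ⌊x l / 2 ^ j⌋ + 1 := by exact_mod_cast a2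
  change ⌊x l / 2 ^ j⌋ = ⌊y l / 2 ^ j⌋
  omega

lemma mem_dilatedCube_of_norm_sub_le {i : ℤ} {x u : EuclideanSpace ℝ (Fin n)}
    (h : ‖x - u‖ ≤ 2 ^ i) : u ∈ dilatedCube i (dyadicIndex i x) := by
  rw [mem_dilatedCube]
  intro l
  have h1 : |x l - u l| ≤ 2 ^ i := (PiLp.norm_apply_le (x - u) l).trans h
  have h2 := mem_dyadicCell.mp (self_mem_dyadicCell i x) l
  rw [abs_le] at h1
  constructor <;> nlinarith [h1.1, h1.2, h2.1, h2.2]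

/-! ### Averages over dilated cubes -/

/-- Normalised Lebesgue measure on a dilated dyadic cube. -/
noncomputable def cubeMeasure (i : ℤ) (k : Fin n → ℤ) : Measure (EuclideanSpace ℝ (Fin n)) :=
  (volume (dilatedCube i k))⁻¹ • volume.restrict (dilatedCube i k)

instance (i : ℤ) (k : Fin n → ℤ) : IsProbabilityMeasure (cubeMeasure i k) := by
  constructor
  rw [cubeMeasure, Measure.smul_apply, Measure.restrict_apply_univ, smul_eq_mul]
  exact ENNReal.inv_mul_cancel (volume_dilatedCube_ne_zero i k) (volume_dilatedCube_ne_top i k)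

lemma lintegral_cubeMeasure (i : ℤ) (k : Fin n → ℤ) (g : EuclideanSpace ℝ (Fin n) → ℝ≥0∞) :
    ∫⁻ u, g u ∂cubeMeasure i k
      = (volume (dilatedCube i k))⁻¹ * ∫⁻ u in dilatedCube i k, g u := by
  rw [cubeMeasure, lintegral_smul_measure, smul_eq_mul]

lemma setLIntegral_dilatedCube (i : ℤ) (k : Fin n → ℤ) (g : EuclideanSpace ℝ (Fin n) → ℝ≥0∞) :
    ∫⁻ u in dilatedCube i k, g u
      = volume (dilatedCube i k) * ∫⁻ u, g u ∂cubeMeasure i k := by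
  rw [lintegral_cubeMeasure, ← mul_assoc, ENNReal.mul_inv_cancel (volume_dilatedCube_ne_zero i k)
    (volume_dilatedCube_ne_top i k), one_mul]

lemma cubeMeasure_congr {i : ℤ} {k : Fin n → ℤ} {g g' : EuclideanSpace ℝ (Fin n) → ℝ≥0∞}
    (h : ∀ u ∈ dilatedCube i k, g u = g' u) :
    ∫⁻ u, g u ∂cubeMeasure i k = ∫⁻ u, g' u ∂cubeMeasure i k := by
  rw [lintegral_cubeMeasure, lintegral_cubeMeasure,
    setLIntegral_congr_fun (measurableSet_dilatedCube i k) h]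

end Grid

/-! ### The maximal function over dilated dyadic cubes -/

/-- The maximal function taking the supremum of the averages of `g` over the dilated dyadic cubes
of all scales attached to the point `x`. -/
noncomputable def cubeMaximal {n : ℕ} (g : EuclideanSpace ℝ (Fin n) → ℝ≥0∞)
    (x : EuclideanSpace ℝ (Fin n)) : ℝ≥0∞ :=
  ⨆ i : ℤ, ∫⁻ u, g u ∂cubeMeasure i (dyadicIndex i x)

section Maximal

variable {n : ℕ}

lemma measurable_comp_dyadicIndex {γ : Type*} [MeasurableSpace γ] (i : ℤ) (φ : (Fin n → ℤ) → γ) :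
    Measurable fun x : EuclideanSpace ℝ (Fin n) => φ (dyadicIndex i x) :=
  (Measurable.of_discrete (f := φ)).comp (measurable_dyadicIndex i)

lemma measurable_cubeMaximal (g : EuclideanSpace ℝ (Fin n) → ℝ≥0∞) :
    Measurable (cubeMaximal g) :=
  Measurable.iSup fun i => measurable_comp_dyadicIndex i fun k => ∫⁻ u, g u ∂cubeMeasure i k

/-- Weak type `(1,1)` bound at scales bounded above, by the Vitali covering theorem: a dilated cube
meeting another one of at least its size lies in the threefold dilate of the latter. -/
lemma mul_volume_biUnion_dyadicCell_le (g : EuclideanSpace ℝ (Fin n) → ℝ≥0∞) (r : ℝ≥0∞) (N : ℕ) :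
    r * volume (⋃ a ∈ {a : ℤ × (Fin n → ℤ) | a.1 ≤ N ∧ r < ∫⁻ u, g u ∂cubeMeasure a.1 a.2},
      dyadicCell a.1 a.2) ≤ 3 ^ n * ∫⁻ u, g u := by
  set t := {a : ℤ × (Fin n → ℤ) | a.1 ≤ N ∧ r < ∫⁻ u, g u ∂cubeMeasure a.1 a.2} with ht
  have hne : ∀ a : ℤ × (Fin n → ℤ), (dilatedCube a.1 a.2).Nonempty := fun a => by
    by_contra h
    rw [Set.not_nonempty_iff_eq_empty] at h
    exact volume_dilatedCube_ne_zero a.1 a.2 (by simp [h])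
  obtain ⟨u, hut, hdisj, hcov⟩ := Vitali.exists_disjoint_subfamily_covering_enlargement
    (fun a : ℤ × (Fin n → ℤ) => dilatedCube a.1 a.2) t (fun a => (2 : ℝ) ^ a.1) (3 / 2)
    (by norm_num) (fun a _ => by positivity) (2 ^ N)
    (fun a ha => by
      rw [← zpow_natCast]
      exact zpow_le_zpow_right₀ (by norm_num) ha.1)
    (fun a _ => hne a)
  let big : ℤ × (Fin n → ℤ) → Set (EuclideanSpace ℝ (Fin n)) := fun a =>
    cube (WithLp.toLp 2 fun l => ((a.2 l : ℝ) - 4) * 2 ^ a.1) (9 * 2 ^ a.1)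
  have hbig : ∀ a, volume (big a) = 3 ^ n * volume (dilatedCube a.1 a.2) := fun a => by
    rw [volume_cube, ENNReal.ofReal_mul (by norm_num), ofReal_two_zpow, volume_dilatedCube,
      ← mul_pow, ← mul_assoc]
    norm_num
  have hsub : (⋃ a ∈ t, dyadicCell a.1 a.2) ⊆ ⋃ b ∈ u, big b := by
    intro x hx
    simp only [Set.mem_iUnion] at hx ⊢
    obtain ⟨a, ha, hxa⟩ := hx
    obtain ⟨b, hb, ⟨y, hya, hyb⟩, hle⟩ := hcov a ha
    refine ⟨b, hb, ?_⟩
    have hxa' := dyadicCell_subset_dilatedCube _ _ hxa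
    rw [mem_dilatedCube] at hya hyb hxa'
    -- the factor `3 / 2` is smaller than the ratio of consecutive scales
    have hab : (2 : ℝ) ^ a.1 ≤ 2 ^ b.1 := by
      have h1 : (2 : ℝ) ^ a.1 < 2 ^ (b.1 + 1) := by
        rw [zpow_add₀ two_ne_zero, zpow_one]
        have : (0 : ℝ) < 2 ^ b.1 := by positivity
        linarith
      rw [zpow_lt_zpow_iff_right₀ (by norm_num)] at h1
      exact zpow_le_zpow_right₀ (by norm_num) (by omega)
    intro l
    have h1 := hya l
    have h2 := hyb l
    have h3 := hxa' l
    simp only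
    constructor <;> nlinarith
  have hone : ∀ b ∈ u, r * volume (big b) ≤ 3 ^ n * ∫⁻ x in dilatedCube b.1 b.2, g x := by
    intro b hb
    rw [hbig, setLIntegral_dilatedCube, mul_left_comm]
    have := (hut hb).2.le
    rw [mul_comm r]
    gcongr
  have hucount : u.Countable := Set.to_countable u
  calc r * volume (⋃ a ∈ t, dyadicCell a.1 a.2)
      ≤ r * volume (⋃ b ∈ u, big b) := by gcongr
    _ ≤ r * ∑' b : u, volume (big b) := by gcongr; exact measure_biUnion_le _ hucount _
    _ = ∑' b : u, r * volume (big b) := ENNReal.tsum_mul_left.symm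
    _ ≤ ∑' b : u, 3 ^ n * ∫⁻ x in dilatedCube b.1.1 b.1.2, g x :=
        ENNReal.tsum_le_tsum fun b => hone b b.2
    _ = 3 ^ n * ∫⁻ x in ⋃ b ∈ u, dilatedCube b.1 b.2, g x := by
        rw [ENNReal.tsum_mul_left, lintegral_biUnion hucount
          (fun b _ => measurableSet_dilatedCube b.1 b.2) hdisj]
    _ ≤ 3 ^ n * ∫⁻ x, g x := mul_le_mul_right (setLIntegral_le_lintegral _ _) _

lemma mul_volume_lt_cubeMaximal_le (g : EuclideanSpace ℝ (Fin n) → ℝ≥0∞) (r : ℝ≥0∞) :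
    r * volume {x | r < cubeMaximal g x} ≤ 3 ^ n * ∫⁻ u, g u := by
  have hmono : Monotone fun N : ℕ =>
      ⋃ a ∈ {a : ℤ × (Fin n → ℤ) | a.1 ≤ N ∧ r < ∫⁻ u, g u ∂cubeMeasure a.1 a.2},
        dyadicCell a.1 a.2 := by
    intro N N' hN
    refine Set.biUnion_subset_biUnion_left fun a ha => ⟨ha.1.trans (by exact_mod_cast hN), ha.2⟩
  have hsub : {x | r < cubeMaximal g x} ⊆ ⋃ N : ℕ,
      ⋃ a ∈ {a : ℤ × (Fin n → ℤ) | a.1 ≤ N ∧ r < ∫⁻ u, g u ∂cubeMeasure a.1 a.2},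
        dyadicCell a.1 a.2 := by
    intro x hx
    obtain ⟨i, hi⟩ := lt_iSup_iff.mp (show r < cubeMaximal g x from hx)
    refine Set.mem_iUnion.mpr ⟨i.toNat, Set.mem_biUnion (x := (i, dyadicIndex i x)) ?_ ?_⟩
    · exact ⟨Int.self_le_toNat i, hi⟩
    · exact self_mem_dyadicCell i x
  refine (mul_le_mul_right (measure_mono hsub) _).trans ?_
  rw [hmono.measure_iUnion, ENNReal.mul_iSup]
  exact iSup_le fun N => mul_volume_biUnion_dyadicCell_le g r N

/-- A power of `t` is controlled by the sum of the same powers of the powers of two below `t`. -/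
lemma rpow_le_tsum_two_rpow {q : ℝ} (hq : 0 < q) (t : ℝ≥0∞) :
    t ^ q ≤ 2 ^ q *
      ∑' k : ℤ, if (2 : ℝ≥0∞) ^ (k : ℝ) < t then ((2 : ℝ≥0∞) ^ (k : ℝ)) ^ q else 0 := by
  have main : ∀ s : ℝ≥0∞, s ≠ ∞ → s ≤ t → s ^ q ≤
      2 ^ q * ∑' k : ℤ, if (2 : ℝ≥0∞) ^ (k : ℝ) < t then ((2 : ℝ≥0∞) ^ (k : ℝ)) ^ q else 0 := by
    intro s hs hst
    rcases eq_or_ne s 0 with rfl | hs0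
    · simp [ENNReal.zero_rpow_of_pos hq]
    obtain ⟨k, hk1, hk2⟩ := ENNReal.exists_mem_Ioc_zpow hs0 hs (by norm_num : (1 : ℝ≥0∞) < 2)
      (by simp)
    rw [← ENNReal.rpow_intCast] at hk1 hk2
    refine le_trans ?_ (mul_le_mul_right (ENNReal.le_tsum k) _)
    rw [if_pos (hk1.trans_le hst), ← ENNReal.mul_rpow_of_nonneg _ _ hq.le]
    refine ENNReal.rpow_le_rpow (hk2.trans_eq ?_) hq.le
    push_cast
    rw [ENNReal.rpow_add _ _ (by simp) (by simp), ENNReal.rpow_one, mul_comm]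
  rcases eq_or_ne t ∞ with rfl | ht
  · rw [ENNReal.top_rpow_of_pos hq, top_le_iff]
    refine ENNReal.eq_top_of_forall_nnreal_le fun r => ?_
    have := main ((r : ℝ≥0∞) ^ (1 / q)) (by simp [hq.le]) le_top
    rwa [← ENNReal.rpow_mul, one_div_mul_cancel hq.ne', ENNReal.rpow_one] at this
  · exact main t ht le_rfl

lemma tsum_two_rpow_le {q : ℝ} (hq : 0 < q) (t : ℝ≥0∞) :
    ∑' k : ℤ, (if (2 : ℝ≥0∞) ^ (k : ℝ) < t then ((2 : ℝ≥0∞) ^ (k : ℝ)) ^ q else 0)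
      ≤ (1 - (2 : ℝ≥0∞) ^ (-q))⁻¹ * t ^ q := by
  rcases eq_or_ne t ∞ with rfl | ht
  · rw [ENNReal.top_rpow_of_pos hq, ENNReal.mul_top]
    · exact le_top
    · exact ENNReal.inv_ne_zero.mpr (ne_top_of_le_ne_top ENNReal.one_ne_top tsub_le_self)
  rcases eq_or_ne t 0 with rfl | ht0
  · simp
  obtain ⟨k₀, hk1, hk2⟩ := ENNReal.exists_mem_Ioc_zpow ht0 ht (by norm_num : (1 : ℝ≥0∞) < 2)
    (by simp)
  rw [← ENNReal.rpow_intCast] at hk1 hk2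
  have hinj : Function.Injective fun l : ℕ => k₀ - (l : ℤ) := fun a b h => by
    simpa using h
  rw [← hinj.tsum_eq]
  · rw [← ENNReal.tsum_geometric, ← ENNReal.tsum_mul_right]
    refine ENNReal.tsum_le_tsum fun l => ?_
    have : ((2 : ℝ≥0∞) ^ (((k₀ - (l : ℤ) : ℤ)) : ℝ)) ^ q
        = ((2 : ℝ≥0∞) ^ (-q)) ^ l * ((2 : ℝ≥0∞) ^ (k₀ : ℝ)) ^ q := by
      rw [← ENNReal.rpow_natCast, ← ENNReal.rpow_mul, ← ENNReal.rpow_mul, ← ENNReal.rpow_mul,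
        ← ENNReal.rpow_add _ _ (by simp) (by simp)]
      congr 1; push_cast; ring
    rw [this]
    split_ifs
    · gcongr
    · exact zero_le
  · intro k hk
    simp only [Function.mem_support, ne_eq, ite_eq_right_iff, Classical.not_imp] at hk
    have h1 := hk.1.trans_le hk2
    have h2 : k < k₀ + 1 := by
      by_contra hcon
      refine h1.not_ge (ENNReal.rpow_le_rpow_of_exponent_le (by norm_num) ?_)
      exact_mod_cast not_lt.mp hcon
    exact ⟨(k₀ - k).toNat, by simp; omega⟩

/-- The maximal function over dilated dyadic cubes is bounded on `L^q` for `q > 1`. The layer cake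
formula is replaced by sums over dyadic levels, which need no finiteness of the functions. -/
lemma exists_lintegral_cubeMaximal_rpow_le (n : ℕ) {q : ℝ} (hq : 1 < q) :
    ∃ K : ℝ≥0∞, K ≠ ∞ ∧ ∀ g : EuclideanSpace ℝ (Fin n) → ℝ≥0∞, Measurable g →
      ∫⁻ x, cubeMaximal g x ^ q ≤ K * ∫⁻ x, g x ^ q := by
  have hq0 : 0 < q := by linarith
  have hq1 : 0 < q - 1 := by linarith
  refine ⟨2 ^ q * (2 * 3 ^ n * ((1 - (2 : ℝ≥0∞) ^ (-(q - 1)))⁻¹ * 2 ^ (q - 1))), ?_, ?_⟩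
  · have : (1 - (2 : ℝ≥0∞) ^ (-(q - 1))) ≠ 0 := by
      rw [ne_eq, tsub_eq_zero_iff_le, not_le]
      exact ENNReal.rpow_lt_one_of_one_lt_of_neg (by norm_num) (by linarith)
    finiteness
  intro g hg
  let gk : ℤ → EuclideanSpace ℝ (Fin n) → ℝ≥0∞ := fun k x =>
    if (2 : ℝ≥0∞) ^ (k : ℝ) < 2 * g x then g x else 0
  have hset : ∀ k : ℤ, MeasurableSet {x | (2 : ℝ≥0∞) ^ (k : ℝ) < 2 * g x} := fun k =>
    measurableSet_lt measurable_const (by fun_prop)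
  have hsetM : ∀ k : ℤ, MeasurableSet {x | (2 : ℝ≥0∞) ^ (k : ℝ) < cubeMaximal g x} := fun k =>
    measurableSet_lt measurable_const (measurable_cubeMaximal g)
  -- values of `g` below half the level do not influence the superlevel set
  have hweak : ∀ k : ℤ, ((2 : ℝ≥0∞) ^ (k : ℝ)) ^ q *
      volume {x | (2 : ℝ≥0∞) ^ (k : ℝ) < cubeMaximal g x}
      ≤ 2 * 3 ^ n * ∫⁻ x, if (2 : ℝ≥0∞) ^ (k : ℝ) < 2 * g x
        then g x * ((2 : ℝ≥0∞) ^ (k : ℝ)) ^ (q - 1) else 0 := by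
    intro k
    set r := (2 : ℝ≥0∞) ^ (k : ℝ) with hr
    have hr0 : r ≠ 0 := two_rpow_ne_zero _
    have hrt : r ≠ ∞ := two_rpow_ne_top _
    have hsub : {x | r < cubeMaximal g x} ⊆ {x | r / 2 < cubeMaximal (gk k) x} := by
      intro x hx
      obtain ⟨i, hi⟩ := lt_iSup_iff.mp (show r < cubeMaximal g x from hx)
      have h1 : ∫⁻ u, g u ∂cubeMeasure i (dyadicIndex i x)
          ≤ ∫⁻ u, gk k u ∂cubeMeasure i (dyadicIndex i x) + r / 2 := by
        calc ∫⁻ u, g u ∂cubeMeasure i (dyadicIndex i x)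
            ≤ ∫⁻ u, gk k u + r / 2 ∂cubeMeasure i (dyadicIndex i x) := by
              refine lintegral_mono fun u => ?_
              simp only [gk]
              split_ifs with h
              · exact le_self_add
              · rw [zero_add, ENNReal.le_div_iff_mul_le (by simp) (by simp), mul_comm]
                exact not_lt.mp h
          _ = _ := by rw [lintegral_add_right _ measurable_const]; simp
      have h2 : r / 2 < ∫⁻ u, gk k u ∂cubeMeasure i (dyadicIndex i x) := by
        by_contra hcon
        have h3 := hi.trans_le (h1.trans (add_le_add_left (not_lt.mp hcon) _))
        rw [ENNReal.add_halves] at h3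
        exact lt_irrefl _ h3
      exact h2.trans_le (le_iSup (fun i => ∫⁻ u, gk k u ∂cubeMeasure i (dyadicIndex i x)) i)
    have hrq : r ^ q = r ^ (q - 1) * (2 * (r / 2)) := by
      rw [ENNReal.mul_div_cancel (by simp) (by simp)]
      nth_rw 3 [← ENNReal.rpow_one r]
      rw [← ENNReal.rpow_add _ _ hr0 hrt, sub_add_cancel]
    calc r ^ q * volume {x | r < cubeMaximal g x}
        ≤ r ^ q * volume {x | r / 2 < cubeMaximal (gk k) x} := by gcongr
      _ = 2 * r ^ (q - 1) * (r / 2 * volume {x | r / 2 < cubeMaximal (gk k) x}) := by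
          rw [hrq]; ring
      _ ≤ 2 * r ^ (q - 1) * (3 ^ n * ∫⁻ u, gk k u) := 
          mul_le_mul_right (mul_volume_lt_cubeMaximal_le _ _) _
      _ = 2 * 3 ^ n * ((∫⁻ u, gk k u) * r ^ (q - 1)) := by ring
      _ = _ := by
          rw [← lintegral_mul_const _ (Measurable.ite (hset k) hg measurable_const)]
          congr 1
          refine lintegral_congr fun x => ?_
          simp only [ite_mul, zero_mul]
          rfl
  calc ∫⁻ x, cubeMaximal g x ^ q
      ≤ ∫⁻ x, 2 ^ q * ∑' k : ℤ, (if (2 : ℝ≥0∞) ^ (k : ℝ) < cubeMaximal g x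
          then ((2 : ℝ≥0∞) ^ (k : ℝ)) ^ q else 0) :=
        lintegral_mono fun x => rpow_le_tsum_two_rpow hq0 _
    _ = 2 ^ q * ∑' k : ℤ, ((2 : ℝ≥0∞) ^ (k : ℝ)) ^ q
          * volume {x | (2 : ℝ≥0∞) ^ (k : ℝ) < cubeMaximal g x} := by
        rw [lintegral_const_mul' _ _ (by simp), lintegral_tsum]
        · congr 2 with k
          rw [← lintegral_indicator_const (hsetM k)]
          refine lintegral_congr fun x => ?_
          simp [Set.indicator_apply]
        · exact fun k => (Measurable.ite (hsetM k) measurable_const measurable_const).aemeasurable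
    _ ≤ 2 ^ q * ∑' k : ℤ, 2 * 3 ^ n * ∫⁻ x, (if (2 : ℝ≥0∞) ^ (k : ℝ) < 2 * g x
          then g x * ((2 : ℝ≥0∞) ^ (k : ℝ)) ^ (q - 1) else 0) := 
        mul_le_mul_right (ENNReal.tsum_le_tsum hweak) _
    _ = 2 ^ q * (2 * 3 ^ n * ∫⁻ x, g x * ∑' k : ℤ, (if (2 : ℝ≥0∞) ^ (k : ℝ) < 2 * g x
          then ((2 : ℝ≥0∞) ^ (k : ℝ)) ^ (q - 1) else 0)) := by
        rw [ENNReal.tsum_mul_left, ← lintegral_tsum]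
        · congr 3 with x
          rw [← ENNReal.tsum_mul_left]
          congr 1 with k
          rw [mul_ite, mul_zero]
        · exact fun k => (Measurable.ite (hset k) (hg.mul_const _) measurable_const).aemeasurable
    _ ≤ 2 ^ q * (2 * 3 ^ n * ∫⁻ x, (1 - (2 : ℝ≥0∞) ^ (-(q - 1)))⁻¹ * 2 ^ (q - 1) * g x ^ q) := by
        refine mul_le_mul_right (mul_le_mul_right (lintegral_mono fun x => ?_) _) _
        refine (mul_le_mul_right (tsum_two_rpow_le hq1 _) _).trans_eq ?_
        rw [ENNReal.mul_rpow_of_nonneg _ _ hq1.le]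
        have : g x ^ q = g x * g x ^ (q - 1) := by
          nth_rw 2 [← ENNReal.rpow_one (g x)]
          rw [← ENNReal.rpow_add_of_nonneg _ _ zero_le_one hq1.le, add_sub_cancel]
        rw [this]; ring
    _ = _ := by
        rw [lintegral_const_mul _ (hg.pow_const _)]; ring

end Maximal

/-! ### Averages over boxes and the strong maximal function -/

section Strong

variable {n m : ℕ}

/-- The average of `h` over the product of the dilated dyadic cubes of scales `i` and `j` attached
to the two components of `z`. -/
noncomputable def boxAverage (i j : ℤ)
    (h : EuclideanSpace ℝ (Fin n) × EuclideanSpace ℝ (Fin m) → ℝ≥0∞)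
    (z : EuclideanSpace ℝ (Fin n) × EuclideanSpace ℝ (Fin m)) : ℝ≥0∞ :=
  ∫⁻ w, h w ∂(cubeMeasure i (dyadicIndex i z.1)).prod (cubeMeasure j (dyadicIndex j z.2))

/-- The strong maximal function: the supremum of the averages over boxes of all pairs of scales. -/
noncomputable def strongMaximal (h : EuclideanSpace ℝ (Fin n) × EuclideanSpace ℝ (Fin m) → ℝ≥0∞)
    (z : EuclideanSpace ℝ (Fin n) × EuclideanSpace ℝ (Fin m)) : ℝ≥0∞ :=
  ⨆ (i : ℤ) (j : ℤ), boxAverage i j h z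

lemma measurable_boxIndex (i j : ℤ) :
    Measurable fun z : EuclideanSpace ℝ (Fin n) × EuclideanSpace ℝ (Fin m) =>
      (dyadicIndex i z.1, dyadicIndex j z.2) :=
  ((measurable_dyadicIndex i).comp measurable_fst).prodMk
    ((measurable_dyadicIndex j).comp measurable_snd)

lemma measurable_comp_boxIndex {γ : Type*} [MeasurableSpace γ] (i j : ℤ)
    (φ : (Fin n → ℤ) → (Fin m → ℤ) → γ) :
    Measurable fun z : EuclideanSpace ℝ (Fin n) × EuclideanSpace ℝ (Fin m) =>
      φ (dyadicIndex i z.1) (dyadicIndex j z.2) := by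
  have h1 : Measurable fun k : (Fin n → ℤ) × (Fin m → ℤ) => φ k.1 k.2 := .of_discrete
  exact h1.comp (measurable_boxIndex i j)

lemma measurable_comp_fst_dyadicIndex {γ : Type*} [MeasurableSpace γ] (j : ℤ)
    {φ : EuclideanSpace ℝ (Fin n) → (Fin m → ℤ) → γ} (hφ : ∀ k, Measurable fun x => φ x k) :
    Measurable fun z : EuclideanSpace ℝ (Fin n) × EuclideanSpace ℝ (Fin m) =>
      φ z.1 (dyadicIndex j z.2) := by
  have h1 : Measurable fun w : EuclideanSpace ℝ (Fin n) × (Fin m → ℤ) => φ w.1 w.2 :=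
    measurable_from_prod_countable_left hφ
  exact h1.comp (measurable_fst.prodMk ((measurable_dyadicIndex j).comp measurable_snd))

lemma measurable_boxAverage (i j : ℤ)
    (h : EuclideanSpace ℝ (Fin n) × EuclideanSpace ℝ (Fin m) → ℝ≥0∞) :
    Measurable (boxAverage i j h) := by
  unfold boxAverage
  exact measurable_comp_boxIndex i j fun k l => ∫⁻ w, h w ∂(cubeMeasure i k).prod (cubeMeasure j l)

lemma measurable_strongMaximal
    (h : EuclideanSpace ℝ (Fin n) × EuclideanSpace ℝ (Fin m) → ℝ≥0∞) :
    Measurable (strongMaximal h) :=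
  Measurable.iSup fun i => Measurable.iSup fun j => measurable_boxAverage i j h

lemma boxAverage_le_strongMaximal (i j : ℤ)
    (h : EuclideanSpace ℝ (Fin n) × EuclideanSpace ℝ (Fin m) → ℝ≥0∞)
    (z : EuclideanSpace ℝ (Fin n) × EuclideanSpace ℝ (Fin m)) :
    boxAverage i j h z ≤ strongMaximal h z :=
  le_iSup₂ (f := fun i j => boxAverage i j h z) i j

lemma measurable_cubeMaximal_slice
    {h : EuclideanSpace ℝ (Fin n) × EuclideanSpace ℝ (Fin m) → ℝ≥0∞} (hh : Measurable h) :
    Measurable fun z : EuclideanSpace ℝ (Fin n) × EuclideanSpace ℝ (Fin m) =>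
      cubeMaximal (fun v => h (z.1, v)) z.2 := by
  unfold cubeMaximal
  refine Measurable.iSup fun j => ?_
  refine measurable_comp_fst_dyadicIndex j (φ := fun x k => ∫⁻ v, h (x, v) ∂cubeMeasure j k) ?_
  intro k
  exact Measurable.lintegral_prod_right' (ν := cubeMeasure j k) hh

lemma strongMaximal_le
    {h : EuclideanSpace ℝ (Fin n) × EuclideanSpace ℝ (Fin m) → ℝ≥0∞} (hh : Measurable h)
    (z : EuclideanSpace ℝ (Fin n) × EuclideanSpace ℝ (Fin m)) :
    strongMaximal h z ≤ cubeMaximal (fun u => cubeMaximal (fun v => h (u, v)) z.2) z.1 := by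
  refine iSup₂_le fun i j => ?_
  rw [boxAverage, lintegral_prod _ hh.aemeasurable]
  refine le_trans (lintegral_mono fun u => ?_)
    (le_iSup (fun i => ∫⁻ u, cubeMaximal (fun v => h (u, v)) z.2 ∂cubeMeasure i _) i)
  exact le_iSup (fun j => ∫⁻ v, h (u, v) ∂cubeMeasure j (dyadicIndex j z.2)) j

/-- The strong maximal function is bounded on `L^q` for `q > 1`, being dominated by the composition
of the maximal functions in each of the two variables. -/
lemma exists_lintegral_strongMaximal_rpow_le (n m : ℕ) {q : ℝ} (hq : 1 < q) :
    ∃ K : ℝ≥0∞, K ≠ ∞ ∧ ∀ h : EuclideanSpace ℝ (Fin n) × EuclideanSpace ℝ (Fin m) → ℝ≥0∞,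
      Measurable h → ∫⁻ z, strongMaximal h z ^ q ≤ K * ∫⁻ z, h z ^ q := by
  obtain ⟨K₁, hK₁, h₁⟩ := exists_lintegral_cubeMaximal_rpow_le n hq
  obtain ⟨K₂, hK₂, h₂⟩ := exists_lintegral_cubeMaximal_rpow_le m hq
  refine ⟨K₁ * K₂, ENNReal.mul_ne_top hK₁ hK₂, fun h hh => ?_⟩
  have hM := measurable_cubeMaximal_slice hh
  have hMx : ∀ y, Measurable fun x => cubeMaximal (fun v => h (x, v)) y := fun y =>
    hM.of_uncurry_right (f := fun x y => cubeMaximal (fun v => h (x, v)) y)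
  calc ∫⁻ z, strongMaximal h z ^ q
      = ∫⁻ y, ∫⁻ x, strongMaximal h (x, y) ^ q :=
        lintegral_prod_symm' _ ((measurable_strongMaximal h).pow_const q)
    _ ≤ ∫⁻ y, K₁ * ∫⁻ x, cubeMaximal (fun v => h (x, v)) y ^ q := by
        refine lintegral_mono fun y => ?_
        refine le_trans (lintegral_mono fun x => ?_) (h₁ _ (hMx y))
        exact ENNReal.rpow_le_rpow (strongMaximal_le hh (x, y)) (by linarith)
    _ = K₁ * ∫⁻ x, ∫⁻ y, cubeMaximal (fun v => h (x, v)) y ^ q := by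
        rw [lintegral_const_mul' _ _ hK₁, lintegral_lintegral_swap
          (f := fun x y => cubeMaximal (fun v => h (x, v)) y ^ q) (hM.pow_const q).aemeasurable]
    _ ≤ K₁ * ∫⁻ x, K₂ * ∫⁻ y, h (x, y) ^ q :=
        mul_le_mul_right (lintegral_mono fun x => h₂ _ (hh.comp measurable_prodMk_left)) _
    _ = _ := by
        rw [lintegral_const_mul' _ _ hK₂, Measure.volume_eq_prod,
          lintegral_prod _ (hh.pow_const q).aemeasurable, mul_assoc]

/-- Jensen's inequality for a power and a probability measure. -/
lemma lintegral_rpow_le_lintegral_rpow {α : Type*} [MeasurableSpace α] {μ : Measure α}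
    [IsProbabilityMeasure μ] {τ : ℝ} (hτ : 1 < τ) {f : α → ℝ≥0∞} (hf : Measurable f) :
    (∫⁻ x, f x ∂μ) ^ τ ≤ ∫⁻ x, f x ^ τ ∂μ := by
  have hc := Real.HolderConjugate.conjExponent hτ
  have h := ENNReal.lintegral_mul_le_Lp_mul_Lq μ hc hf.aemeasurable
    (measurable_const (a := (1 : ℝ≥0∞))).aemeasurable
  simp only [Pi.mul_apply, mul_one, ENNReal.one_rpow, lintegral_one, measure_univ] at h
  rw [one_div, ENNReal.le_rpow_inv_iff (by linarith)] at h
  exact h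

/-- Chebyshev's inequality at a level that is a multiple of the number controlling the norm; the
cases in which that number is `0` or `∞` are included. -/
lemma measure_mul_lt_le {α : Type*} [MeasurableSpace α] {μ : Measure α} {τ : ℝ} (hτ : 0 < τ)
    {H : α → ℝ≥0∞} (hH : Measurable H) {V b c : ℝ≥0∞} (hc0 : c ≠ 0)
    (h : ∫⁻ x, H x ^ τ ∂μ ≤ V * b ^ τ) : μ {x | c * b < H x} ≤ V * (c ^ τ)⁻¹ := by
  rcases eq_or_ne c ∞ with rfl | hct
  · rcases eq_or_ne b 0 with rfl | hb0
    · rw [ENNReal.zero_rpow_of_pos hτ, mul_zero, nonpos_iff_eq_zero,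
        lintegral_eq_zero_iff (hH.pow_const τ)] at h
      have : μ {x | ∞ * 0 < H x} = 0 := by
        rw [mul_zero]
        refine measure_mono_null (fun x hx => ?_) h
        simpa [hτ.not_gt, hτ] using (Set.mem_ofPred_eq.mp hx).ne'
      rw [this]; exact zero_le
    · simp [ENNReal.top_mul hb0]
  rcases eq_or_ne b ∞ with rfl | hbt
  · simp [ENNReal.mul_top hc0]
  rcases eq_or_ne b 0 with rfl | hb0
  · rw [ENNReal.zero_rpow_of_pos hτ, mul_zero, nonpos_iff_eq_zero,
      lintegral_eq_zero_iff (hH.pow_const τ)] at h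
    have : μ {x | c * 0 < H x} = 0 := by
      rw [mul_zero]
      refine measure_mono_null (fun x hx => ?_) h
      simpa [hτ.not_gt, hτ] using (Set.mem_ofPred_eq.mp hx).ne'
    rw [this]; exact zero_le
  · have hbτ0 : b ^ τ ≠ 0 := by simp [hb0, hbt]
    have hbτt : b ^ τ ≠ ∞ := by simp [hb0, hbt]
    have hcτ0 : c ^ τ ≠ 0 := by simp [hc0, hct]
    have hcτt : c ^ τ ≠ ∞ := by simp [hc0, hct]
    have h1 : (c * b) ^ τ * μ {x | c * b < H x} ≤ V * b ^ τ := by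
      refine le_trans ?_ ((mul_meas_ge_le_lintegral (hH.pow_const τ) ((c * b) ^ τ)).trans h)
      refine mul_le_mul_right (measure_mono fun x hx => ?_) _
      exact ENNReal.rpow_le_rpow (le_of_lt hx) hτ.le
    rw [ENNReal.mul_rpow_of_nonneg _ _ hτ.le, mul_right_comm,
      ENNReal.mul_le_mul_iff_left hbτ0 hbτt] at h1
    rw [← div_eq_mul_inv, ENNReal.le_div_iff_mul_le (.inl hcτ0) (.inl hcτt), mul_comm]
    exact h1

end Strong

section Boxes

variable {n m : ℕ}

lemma prod_cubeMeasure (i j : ℤ) (k : Fin n → ℤ) (l : Fin m → ℤ) :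
    (cubeMeasure i k).prod (cubeMeasure j l)
      = (volume (dilatedCube i k) * volume (dilatedCube j l))⁻¹ •
        volume.restrict (dilatedCube i k ×ˢ dilatedCube j l) := by
  rw [cubeMeasure, cubeMeasure, Measure.prod_smul_left, Measure.prod_smul_right,
    Measure.prod_restrict, smul_smul, ← Measure.volume_eq_prod,
    ENNReal.mul_inv (.inl (volume_dilatedCube_ne_zero i k)) (.inl (volume_dilatedCube_ne_top i k))]

lemma setLIntegral_dilatedCube_prod (i j : ℤ) (k : Fin n → ℤ) (l : Fin m → ℤ)
    (h : EuclideanSpace ℝ (Fin n) × EuclideanSpace ℝ (Fin m) → ℝ≥0∞) :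
    ∫⁻ w in dilatedCube i k ×ˢ dilatedCube j l, h w
      = volume (dilatedCube i k) * volume (dilatedCube j l)
        * ∫⁻ w, h w ∂(cubeMeasure i k).prod (cubeMeasure j l) := by
  rw [prod_cubeMeasure, lintegral_smul_measure, smul_eq_mul, ← mul_assoc, ENNReal.mul_inv_cancel,
    one_mul]
  · exact mul_ne_zero (volume_dilatedCube_ne_zero i k) (volume_dilatedCube_ne_zero j l)
  · exact ENNReal.mul_ne_top (volume_dilatedCube_ne_top i k) (volume_dilatedCube_ne_top j l)

lemma exists_volume_lt_cubeMaximal_indicator_le (n : ℕ) {τ : ℝ} (hτ : 1 < τ) :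
    ∃ K : ℝ≥0∞, K ≠ ∞ ∧ ∀ g : EuclideanSpace ℝ (Fin n) → ℝ≥0∞, Measurable g →
      ∀ (i : ℤ) (k : Fin n → ℤ) (b c : ℝ≥0∞), c ≠ 0 → ∫⁻ u, g u ^ τ ∂cubeMeasure i k ≤ b ^ τ →
        volume {x | c * b < cubeMaximal ((dilatedCube i k).indicator g) x}
          ≤ K * volume (dyadicCell i k) * (c ^ τ)⁻¹ := by
  have hτ0 : 0 < τ := by linarith
  obtain ⟨K, hK, hM⟩ := exists_lintegral_cubeMaximal_rpow_le n hτ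
  refine ⟨K * 3 ^ n, by finiteness, fun g hg i k b c hc hb => ?_⟩
  refine measure_mul_lt_le hτ0 (measurable_cubeMaximal _) hc ?_
  refine (hM _ (hg.indicator (measurableSet_dilatedCube i k))).trans ?_
  have h1 : ∀ x, (dilatedCube i k).indicator g x ^ τ
      = (dilatedCube i k).indicator (fun x => g x ^ τ) x := fun x => by
    by_cases hx : x ∈ dilatedCube i k <;> simp [hx, hτ0]
  rw [lintegral_congr h1]
  rw [lintegral_indicator (measurableSet_dilatedCube i k), setLIntegral_dilatedCube,
    volume_dilatedCube_eq, mul_assoc K, mul_assoc K]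
  gcongr

lemma exists_volume_lt_strongMaximal_indicator_le (n m : ℕ) {τ : ℝ} (hτ : 1 < τ) :
    ∃ K : ℝ≥0∞, K ≠ ∞ ∧ ∀ h : EuclideanSpace ℝ (Fin n) × EuclideanSpace ℝ (Fin m) → ℝ≥0∞,
      Measurable h → ∀ (i j : ℤ) (k : Fin n → ℤ) (l : Fin m → ℤ) (b c : ℝ≥0∞), c ≠ 0 →
        ∫⁻ w, h w ^ τ ∂(cubeMeasure i k).prod (cubeMeasure j l) ≤ b ^ τ →
        volume {z | c * b < strongMaximal ((dilatedCube i k ×ˢ dilatedCube j l).indicator h) z}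
          ≤ K * (volume (dyadicCell i k) * volume (dyadicCell j l)) * (c ^ τ)⁻¹ := by
  have hτ0 : 0 < τ := by linarith
  obtain ⟨K, hK, hM⟩ := exists_lintegral_strongMaximal_rpow_le n m hτ
  refine ⟨K * (3 ^ n * 3 ^ m), by finiteness, fun h hh i j k l b c hc hb => ?_⟩
  refine measure_mul_lt_le hτ0 (measurable_strongMaximal _) hc ?_
  have hS := (measurableSet_dilatedCube i k).prod (measurableSet_dilatedCube j l)
  refine (hM _ (hh.indicator hS)).trans ?_
  have h1 : ∀ x, (dilatedCube i k ×ˢ dilatedCube j l).indicator h x ^ τ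
      = (dilatedCube i k ×ˢ dilatedCube j l).indicator (fun x => h x ^ τ) x := fun x => by
    by_cases hx : x ∈ dilatedCube i k ×ˢ dilatedCube j l <;>
      simp only [hx, Set.indicator_of_mem, Set.indicator_of_notMem, not_false_eq_true,
        ENNReal.zero_rpow_of_pos hτ0]
  rw [lintegral_congr h1]
  rw [lintegral_indicator hS, setLIntegral_dilatedCube_prod, volume_dilatedCube_eq,
    volume_dilatedCube_eq]
  calc _ ≤ K * (3 ^ n * volume (dyadicCell i k) * (3 ^ m * volume (dyadicCell j l)) * b ^ τ) := by
        gcongr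
    _ = _ := by ring

/-! ### Points at which the averages of a weight are under control -/

/-- The set of points `z` for which the average of `h` over any box at `z` that is not strictly
larger in both directions than the box of scales `(i, j)` is controlled by the `L^τ` average over
the join of the two boxes, up to the `δ`-th power of the ratio of the sides of the join to those of
the box of scales `(i, j)`. -/
def goodSet (τ δ : ℝ) (C : ℝ≥0∞) (i j : ℤ)
    (h : EuclideanSpace ℝ (Fin n) × EuclideanSpace ℝ (Fin m) → ℝ≥0∞) :
    Set (EuclideanSpace ℝ (Fin n) × EuclideanSpace ℝ (Fin m)) :=
  {z | ∀ i' j' : ℤ, (i' ≤ i ∨ j' ≤ j) → boxAverage i' j' h z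
    ≤ C * 2 ^ (δ * ((max i i' - i + (max j j' - j) : ℤ) : ℝ))
      * boxAverage (max i i') (max j j') (fun w => h w ^ τ) z ^ (1 / τ)}

lemma measurableSet_goodSet (τ δ : ℝ) (C : ℝ≥0∞) (i j : ℤ)
    (h : EuclideanSpace ℝ (Fin n) × EuclideanSpace ℝ (Fin m) → ℝ≥0∞) :
    MeasurableSet (goodSet τ δ C i j h) := by
  have : goodSet τ δ C i j h = ⋂ (i' : ℤ) (j' : ℤ) (_ : i' ≤ i ∨ j' ≤ j),
      {z | boxAverage i' j' h z
        ≤ C * 2 ^ (δ * ((max i i' - i + (max j j' - j) : ℤ) : ℝ))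
          * boxAverage (max i i') (max j j') (fun w => h w ^ τ) z ^ (1 / τ)} := by
    ext; simp [goodSet]
  rw [this]
  refine MeasurableSet.iInter fun i' => MeasurableSet.iInter fun j' => MeasurableSet.iInter fun _ =>
    measurableSet_le (measurable_boxAverage _ _ _)
      (((measurable_boxAverage _ _ _).pow_const _).const_mul _)

lemma rpow_one_div_rpow {τ : ℝ} (hτ : 0 < τ) (t : ℝ≥0∞) : (t ^ (1 / τ)) ^ τ = t := by
  rw [← ENNReal.rpow_mul, one_div_mul_cancel hτ.ne', ENNReal.rpow_one]

lemma boxAverage_le_strongMaximal_indicator {i j i' j' : ℤ} (hi : i' ≤ i) (hj : j' ≤ j)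
    {h : EuclideanSpace ℝ (Fin n) × EuclideanSpace ℝ (Fin m) → ℝ≥0∞} (hh : Measurable h)
    (z : EuclideanSpace ℝ (Fin n) × EuclideanSpace ℝ (Fin m)) :
    boxAverage i' j' h z ≤ strongMaximal ((dilatedCube i (dyadicIndex i z.1) ×ˢ
      dilatedCube j (dyadicIndex j z.2)).indicator h) z := by
  have hS := (measurableSet_dilatedCube i (dyadicIndex i z.1)).prod
    (measurableSet_dilatedCube j (dyadicIndex j z.2))
  refine le_trans (le_of_eq ?_) (boxAverage_le_strongMaximal i' j' _ z)
  rw [boxAverage, boxAverage, lintegral_prod _ hh.aemeasurable,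
    lintegral_prod _ (hh.indicator hS).aemeasurable]
  refine cubeMeasure_congr fun u hu => cubeMeasure_congr fun v hv => ?_
  rw [Set.indicator_of_mem]
  exact ⟨dilatedCube_mono hi _ hu, dilatedCube_mono hj _ hv⟩

/-- The complement of the good set is a small part of every cell. For boxes contained in the given
one this is the strong maximal theorem; for boxes that are longer in one direction, the exceptional
set is a cylinder over a superlevel set of a one-variable maximal function, and the sum over the
lengths converges because of the factor `2 ^ (δ * d)`. -/
lemma exists_volume_diff_goodSet_le (n m : ℕ) {τ δ : ℝ} (hτ : 1 < τ) (hδ : 0 < δ) :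
    ∃ C : ℝ≥0∞, C ≠ ∞ ∧ ∀ h : EuclideanSpace ℝ (Fin n) × EuclideanSpace ℝ (Fin m) → ℝ≥0∞,
      Measurable h → ∀ (i j : ℤ) (k : Fin n → ℤ) (l : Fin m → ℤ),
        volume ((dyadicCell i k ×ˢ dyadicCell j l) \ goodSet τ δ C i j h)
          ≤ 4⁻¹ * (volume (dyadicCell i k) * volume (dyadicCell j l)) := by
  have hτ0 : 0 < τ := by linarith
  obtain ⟨K₀, hK₀, h₀⟩ := exists_volume_lt_strongMaximal_indicator_le n m hτ
  obtain ⟨K₁, hK₁, h₁⟩ := exists_volume_lt_cubeMaximal_indicator_le n hτ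
  obtain ⟨K₂, hK₂, h₂⟩ := exists_volume_lt_cubeMaximal_indicator_le m hτ
  set S : ℝ≥0∞ := (1 - (2 : ℝ≥0∞) ^ (-(δ * τ)))⁻¹ with hSdef
  have hS : S ≠ ∞ := by
    rw [hSdef, ENNReal.inv_ne_top, ne_eq, tsub_eq_zero_iff_le, not_le]
    exact ENNReal.rpow_lt_one_of_one_lt_of_neg (by norm_num) (by nlinarith)
  set K : ℝ≥0∞ := K₀ + (K₁ + K₂) * S with hKdef
  have hK : K ≠ ∞ := by finiteness
  -- the constant is chosen such that the total measure `K * (C ^ τ)⁻¹` is at most `1 / 4`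
  set C : ℝ≥0∞ := (4 * (K + 1)) ^ (1 / τ) with hCdef
  have hCτ : C ^ τ = 4 * (K + 1) := rpow_one_div_rpow hτ0 _
  have hC0 : C ≠ 0 := by
    rw [hCdef, ne_eq, ENNReal.rpow_eq_zero_iff_of_pos (by positivity)]; simp
  have hCt : C ≠ ∞ := by
    refine ENNReal.rpow_ne_top_of_nonneg (by positivity) (by finiteness)
  have hKC : K * (C ^ τ)⁻¹ ≤ 4⁻¹ := by
    rw [hCτ, ENNReal.mul_inv (by simp) (by simp), mul_left_comm]
    refine mul_le_of_le_one_right zero_le ?_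
    rw [← div_eq_mul_inv]
    exact ENNReal.div_le_of_le_mul (by simp)
  refine ⟨C, hCt, fun h hh i j k l => ?_⟩
  have hne : ∀ {N : ℕ} (i : ℤ) (k : Fin N → ℤ), (dyadicCell i k).Nonempty := fun i k => by
    by_contra hcon
    exact volume_dyadicCell_ne_zero i k (by simp [Set.not_nonempty_iff_eq_empty.mp hcon])
  obtain ⟨x₀, hx₀⟩ := hne i k
  obtain ⟨y₀, hy₀⟩ := hne j l
  have hx₀' : dyadicIndex i x₀ = k := hx₀
  have hy₀' : dyadicIndex j y₀ = l := hy₀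
  set V := volume (dyadicCell i k) with hV
  set W := volume (dyadicCell j l) with hW
  have hhτ : Measurable fun w => h w ^ τ := hh.pow_const τ
  let c : ℕ → ℝ≥0∞ := fun d => C * 2 ^ (δ * (d : ℝ))
  have hc0 : ∀ d, c d ≠ 0 := fun d => mul_ne_zero hC0 (two_rpow_ne_zero _)
  have hcτ : ∀ d, (c d ^ τ)⁻¹ = (C ^ τ)⁻¹ * ((2 : ℝ≥0∞) ^ (-(δ * τ))) ^ d := fun d => by
    simp only [c]
    rw [ENNReal.mul_rpow_of_nonneg _ _ hτ0.le,
      ENNReal.mul_inv (.inr (by simp)) (.inr (by simp))]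
    congr 1
    rw [← ENNReal.rpow_neg, ← ENNReal.rpow_mul, ← ENNReal.rpow_natCast, ← ENNReal.rpow_mul]
    congr 1; ring
  have hcsum : ∑' d, (c d ^ τ)⁻¹ = (C ^ τ)⁻¹ * S := by
    simp only [hcτ]; rw [ENNReal.tsum_mul_left, ENNReal.tsum_geometric]
  let b : ℤ → ℤ → ℝ≥0∞ := fun i' j' => boxAverage i' j' (fun w => h w ^ τ) (x₀, y₀) ^ (1 / τ)
  have hb : ∀ i' j', b i' j' ^ τ = boxAverage i' j' (fun w => h w ^ τ) (x₀, y₀) := fun i' j' =>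
    rpow_one_div_rpow hτ0 _
  let B₀ : Set (EuclideanSpace ℝ (Fin n) × EuclideanSpace ℝ (Fin m)) :=
    {z | C * b i j < strongMaximal ((dilatedCube i k ×ˢ dilatedCube j l).indicator h) z}
  let B₁ : ℕ → Set (EuclideanSpace ℝ (Fin n)) := fun d =>
    {x | c d * b i (j + d) < cubeMaximal ((dilatedCube i k).indicator fun u =>
      ∫⁻ v, h (u, v) ∂cubeMeasure (j + d) (dyadicIndex (j + d) y₀)) x}
  let B₂ : ℕ → Set (EuclideanSpace ℝ (Fin m)) := fun d =>
    {y | c d * b (i + d) j < cubeMaximal ((dilatedCube j l).indicator fun v =>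
      ∫⁻ u, h (u, v) ∂cubeMeasure (i + d) (dyadicIndex (i + d) x₀)) y}
  have hB₀ : volume B₀ ≤ K₀ * (V * W) * (C ^ τ)⁻¹ := by
    refine h₀ h hh i j k l (b i j) C hC0 ?_
    rw [hb, boxAverage, hx₀', hy₀']
  have hB₁ : ∀ d, volume (B₁ d) ≤ K₁ * V * (c d ^ τ)⁻¹ := fun d => by
    refine h₁ _ hh.lintegral_prod_right' i k _ _ (hc0 d) ?_
    rw [hb, boxAverage, lintegral_prod _ hhτ.aemeasurable, hx₀']
    exact lintegral_mono fun u =>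
      lintegral_rpow_le_lintegral_rpow hτ (hh.comp measurable_prodMk_left)
  have hB₂ : ∀ d, volume (B₂ d) ≤ K₂ * W * (c d ^ τ)⁻¹ := fun d => by
    refine h₂ _ hh.lintegral_prod_left' j l _ _ (hc0 d) ?_
    rw [hb, boxAverage, lintegral_prod_symm _ hhτ.aemeasurable, hy₀']
    exact lintegral_mono fun v =>
      lintegral_rpow_le_lintegral_rpow hτ (hh.comp measurable_prodMk_right)
  have hcover : (dyadicCell i k ×ˢ dyadicCell j l) \ goodSet τ δ C i j h
      ⊆ B₀ ∪ ((⋃ d, B₁ d ×ˢ dyadicCell j l) ∪ ⋃ d, dyadicCell i k ×ˢ B₂ d) := by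
    rintro z ⟨⟨hzx, hzy⟩, hz⟩
    have hzx' : dyadicIndex i z.1 = k := hzx
    have hzy' : dyadicIndex j z.2 = l := hzy
    have hidx : ∀ i', i ≤ i' → dyadicIndex i' z.1 = dyadicIndex i' x₀ := fun i' hi' =>
      dyadicIndex_eq_of_le hi' (hzx'.trans hx₀'.symm)
    have hidy : ∀ j', j ≤ j' → dyadicIndex j' z.2 = dyadicIndex j' y₀ := fun j' hj' =>
      dyadicIndex_eq_of_le hj' (hzy'.trans hy₀'.symm)
    simp only [goodSet, Set.mem_ofPred_eq, not_forall, not_le] at hz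
    obtain ⟨i', j', hor, hlt⟩ := hz
    have hbz : boxAverage (max i i') (max j j') (fun w => h w ^ τ) z ^ (1 / τ)
        = b (max i i') (max j j') := by
      simp only [b, boxAverage, hidx _ (le_max_left i i'), hidy _ (le_max_left j j')]
    rw [hbz] at hlt
    rcases le_or_gt i' i with hi | hi
    · rcases le_or_gt j' j with hj | hj
      · refine Or.inl ?_
        have := boxAverage_le_strongMaximal_indicator hi hj hh z
        rw [hzx', hzy'] at this
        rw [max_eq_left hi, max_eq_left hj] at hlt
        refine lt_of_lt_of_le ?_ this
        simpa using hlt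
      · refine Or.inr (Or.inl (Set.mem_iUnion.mpr ⟨(j' - j).toNat, ?_, hzy⟩))
        have hd : ((j' - j).toNat : ℤ) = j' - j := Int.toNat_of_nonneg (by omega)
        have hd' : j + ((j' - j).toNat : ℤ) = j' := by omega
        rw [max_eq_left hi, max_eq_right hj.le, sub_self, zero_add, ← hd] at hlt
        refine lt_of_lt_of_le ?_ (le_iSup (fun i => ∫⁻ u, _ ∂cubeMeasure i (dyadicIndex i z.1)) i')
        simp only [hd', c]
        rw [Int.cast_natCast] at hlt
        refine hlt.trans_eq ?_
        rw [boxAverage, lintegral_prod _ hh.aemeasurable, hidy _ hj.le]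
        refine cubeMeasure_congr fun u hu => ?_
        rw [Set.indicator_of_mem]
        rw [← hzx']; exact dilatedCube_mono hi _ hu
    · have hj : j' ≤ j := hor.resolve_left (not_le.mpr hi)
      refine Or.inr (Or.inr (Set.mem_iUnion.mpr ⟨(i' - i).toNat, hzx, ?_⟩))
      have hd : ((i' - i).toNat : ℤ) = i' - i := Int.toNat_of_nonneg (by omega)
      have hd' : i + ((i' - i).toNat : ℤ) = i' := by omega
      rw [max_eq_left hj, max_eq_right hi.le, sub_self, add_zero, ← hd] at hlt
      refine lt_of_lt_of_le ?_ (le_iSup (fun j => ∫⁻ v, _ ∂cubeMeasure j (dyadicIndex j z.2)) j')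
      simp only [hd', c]
      rw [Int.cast_natCast] at hlt
      refine hlt.trans_eq ?_
      rw [boxAverage, lintegral_prod_symm _ hh.aemeasurable, hidx _ hi.le]
      refine cubeMeasure_congr fun v hv => ?_
      rw [Set.indicator_of_mem]
      rw [← hzy']; exact dilatedCube_mono hj _ hv
  calc volume ((dyadicCell i k ×ˢ dyadicCell j l) \ goodSet τ δ C i j h)
      ≤ volume B₀ + (∑' d, volume (B₁ d ×ˢ dyadicCell j l)
          + ∑' d, volume (dyadicCell i k ×ˢ B₂ d)) := by
        refine (measure_mono hcover).trans ((measure_union_le _ _).trans ?_)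
        refine add_le_add le_rfl ((measure_union_le _ _).trans ?_)
        exact add_le_add (measure_iUnion_le _) (measure_iUnion_le _)
    _ ≤ K₀ * (V * W) * (C ^ τ)⁻¹ + (∑' d, K₁ * V * W * (c d ^ τ)⁻¹
          + ∑' d, K₂ * V * W * (c d ^ τ)⁻¹) := by
        refine add_le_add hB₀ (add_le_add (ENNReal.tsum_le_tsum fun d => ?_)
          (ENNReal.tsum_le_tsum fun d => ?_))
        · rw [Measure.volume_eq_prod, Measure.prod_prod]
          calc _ ≤ K₁ * V * (c d ^ τ)⁻¹ * W := by gcongr; exact hB₁ d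
            _ = _ := by ring
        · rw [Measure.volume_eq_prod, Measure.prod_prod]
          calc _ ≤ V * (K₂ * W * (c d ^ τ)⁻¹) := by gcongr; exact hB₂ d
            _ = _ := by ring
    _ = K * (C ^ τ)⁻¹ * (V * W) := by
        rw [ENNReal.tsum_mul_left, ENNReal.tsum_mul_left, hcsum]; ring
    _ ≤ 4⁻¹ * (V * W) := by gcongr

end Boxes

/-! ### Summation over the scales -/

lemma tsum_int_two_rpow_neg_abs_ne_top {ε : ℝ} (hε : 0 < ε) :
    ∑' k : ℤ, (2 : ℝ≥0∞) ^ (-(ε * ((|k| : ℤ) : ℝ))) ≠ ∞ := by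
  have hr : (2 : ℝ≥0∞) ^ (-ε) < 1 :=
    ENNReal.rpow_lt_one_of_one_lt_of_neg (by norm_num) (by linarith)
  have hfin : (1 - (2 : ℝ≥0∞) ^ (-ε))⁻¹ ≠ ∞ := by
    rw [ENNReal.inv_ne_top, ne_eq, tsub_eq_zero_iff_le, not_le]; exact hr
  have h1 : ∀ d : ℕ, (2 : ℝ≥0∞) ^ (-(ε * (d : ℝ))) = ((2 : ℝ≥0∞) ^ (-ε)) ^ d := fun d => by
    rw [← ENNReal.rpow_natCast, ← ENNReal.rpow_mul]; congr 1; ring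
  rw [tsum_of_nat_of_neg_add_one ENNReal.summable ENNReal.summable]
  refine ENNReal.add_ne_top.mpr ⟨?_, ?_⟩
  · refine ne_top_of_le_ne_top hfin ?_
    rw [← ENNReal.tsum_geometric]
    exact ENNReal.tsum_le_tsum fun d => by simp [h1]
  · refine ne_top_of_le_ne_top hfin ?_
    rw [← ENNReal.tsum_geometric]
    refine ENNReal.tsum_le_tsum fun d => ?_
    rw [← h1]
    refine ENNReal.rpow_le_rpow_of_exponent_le (by norm_num) ?_
    have : (d : ℝ) ≤ ((|(-((d : ℤ) + 1))| : ℤ) : ℝ) := by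
      rw [abs_neg, abs_of_nonneg (by positivity)]; push_cast; linarith
    nlinarith

/-- A family of numbers indexed by `ℤ × ℤ` whose pairwise products decay geometrically in the
distance of the indices is summable, with a bound: comparing each term with a nearly largest one
shows that the terms themselves decay geometrically away from the index of the latter. -/
lemma exists_tsum_le_of_mul_le {ε : ℝ} (hε : 0 < ε) :
    ∃ C : ℝ≥0∞, C ≠ ∞ ∧ ∀ (c : ℤ × ℤ → ℝ≥0∞) (B : ℝ≥0∞), B ≠ ∞ →
      (∀ r s, c r * c s ≤ B ^ 2 * 2 ^ (-(ε * ((|r.1 - s.1| + |r.2 - s.2| : ℤ) : ℝ)))) →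
      ∑' r, c r ≤ C * B := by
  set T := ∑' k : ℤ, (2 : ℝ≥0∞) ^ (-(ε / 2 * ((|k| : ℤ) : ℝ))) with hTdef
  have hT : T ≠ ∞ := tsum_int_two_rpow_neg_abs_ne_top (half_pos hε)
  refine ⟨2 * (T * T), by finiteness, fun c B hB h => ?_⟩
  set S := ⨆ r, c r with hS
  have hsq : ∀ {a b : ℝ≥0∞}, a ^ 2 ≤ b ^ 2 → a ≤ b := fun hab => by
    by_contra hcon
    exact absurd hab (not_le.mpr (ENNReal.pow_right_strictMono two_ne_zero (not_le.mp hcon)))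
  have hSB : S ≤ B := iSup_le fun r => by
    refine hsq ?_
    have := h r r
    simpa [sq] using this
  rcases eq_or_ne S 0 with hS0 | hS0
  · have : ∀ r, c r = 0 := fun r => le_antisymm ((le_iSup c r).trans hS0.le) zero_le
    simp [this]
  have hSt : S ≠ ∞ := ne_top_of_le_ne_top hB hSB
  obtain ⟨s, hs⟩ := lt_iSup_iff.mp (show S / 2 < ⨆ r, c r from ENNReal.half_lt_self hS0 hSt)
  have hs' : S ≤ 2 * c s := by
    rw [mul_comm, ← ENNReal.div_le_iff_le_mul (by simp) (by simp)]; exact hs.le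
  have hterm : ∀ r, c r ≤ 2 * B * (2 ^ (-(ε / 2 * ((|r.1 - s.1| : ℤ) : ℝ)))
      * 2 ^ (-(ε / 2 * ((|r.2 - s.2| : ℤ) : ℝ)))) := fun r => by
    refine hsq ?_
    calc c r ^ 2 ≤ c r * (2 * c s) := by
          rw [sq]; exact mul_le_mul_right ((le_iSup c r).trans hs') _
      _ = 2 * (c r * c s) := by ring
      _ ≤ 2 * (B ^ 2 * 2 ^ (-(ε * ((|r.1 - s.1| + |r.2 - s.2| : ℤ) : ℝ)))) :=
          mul_le_mul_right (h r s) _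
      _ ≤ 4 * (B ^ 2 * 2 ^ (-(ε * ((|r.1 - s.1| + |r.2 - s.2| : ℤ) : ℝ)))) := by
          gcongr; norm_num
      _ = _ := by
          rw [← ENNReal.rpow_add _ _ (by simp) (by simp), mul_pow (2 * B), mul_pow,
            ← ENNReal.rpow_natCast ((2 : ℝ≥0∞) ^ _), ← ENNReal.rpow_mul, mul_assoc]
          congr 1
          · norm_num
          · congr 2; push_cast; ring
  calc ∑' r, c r ≤ ∑' r : ℤ × ℤ, 2 * B * (2 ^ (-(ε / 2 * ((|r.1 - s.1| : ℤ) : ℝ)))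
      * 2 ^ (-(ε / 2 * ((|r.2 - s.2| : ℤ) : ℝ)))) := ENNReal.tsum_le_tsum hterm
    _ = 2 * B * (T * T) := by
        rw [ENNReal.tsum_mul_left, ENNReal.tsum_prod']
        simp only [ENNReal.tsum_mul_left]
        have hshift : ∀ a : ℤ, ∑' k : ℤ, (2 : ℝ≥0∞) ^ (-(ε / 2 * ((|k - a| : ℤ) : ℝ))) = T :=
          fun a => (Equiv.subRight a).tsum_eq
            fun k : ℤ => (2 : ℝ≥0∞) ^ (-(ε / 2 * ((|k| : ℤ) : ℝ)))
        rw [hshift, ENNReal.tsum_mul_right, hshift]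
    _ = _ := by ring

section Coefficients

variable {n m : ℕ}

/-- The quantity attached to a box by two weights, without bumps. -/
noncomputable def boxCoefficient (α β a b : ℝ)
    (h₁ h₂ : EuclideanSpace ℝ (Fin n) × EuclideanSpace ℝ (Fin m) → ℝ≥0∞) (i j : ℤ)
    (z : EuclideanSpace ℝ (Fin n) × EuclideanSpace ℝ (Fin m)) : ℝ≥0∞ :=
  2 ^ (α * i + β * j) * (boxAverage i j h₁ z ^ a * boxAverage i j h₂ z ^ b)

/-- On the good set of a box, the quantity attached to another box is controlled by the bumped
quantity of the join of the two boxes, and hence gains a power of the ratio of the sizes. -/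
lemma boxCoefficient_le {α β a b τ δ : ℝ} (ha : 0 < a) (hb : 0 < b) (hab : a + b ≤ 1) (hδ : 0 < δ)
    {C A : ℝ≥0∞} {h₁ h₂ : EuclideanSpace ℝ (Fin n) × EuclideanSpace ℝ (Fin m) → ℝ≥0∞}
    {z : EuclideanSpace ℝ (Fin n) × EuclideanSpace ℝ (Fin m)} {i j i' j' : ℤ}
    (hA : 2 ^ (α * (max i i' : ℤ) + β * (max j j' : ℤ))
      * (boxAverage (max i i') (max j j') (fun w => h₁ w ^ τ) z ^ (a / τ)
        * boxAverage (max i i') (max j j') (fun w => h₂ w ^ τ) z ^ (b / τ)) ≤ A)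
    (hz₁ : z ∈ goodSet τ δ C i j h₁) (hz₂ : z ∈ goodSet τ δ C i j h₂)
    (hor : i' ≤ i ∨ j' ≤ j) :
    boxCoefficient α β a b h₁ h₂ i' j' z ≤ C ^ (a + b) * A
      * 2 ^ (δ * ((max i i' - i + (max j j' - j) : ℤ) : ℝ)
        - α * ((max i i' - i' : ℤ) : ℝ) - β * ((max j j' - j' : ℤ) : ℝ)) := by
  set D : ℤ := max i i' - i + (max j j' - j) with hD
  set X := boxAverage (max i i') (max j j') (fun w => h₁ w ^ τ) z with hX
  set Y := boxAverage (max i i') (max j j') (fun w => h₂ w ^ τ) z with hY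
  have hD0 : (0 : ℝ) ≤ (D : ℝ) := by
    have : 0 ≤ D := by omega
    exact_mod_cast this
  have hsplit : ∀ {c : ℝ} (t : ℝ≥0∞), 0 < c →
      (C * 2 ^ (δ * (D : ℝ)) * t ^ (1 / τ)) ^ c = C ^ c * 2 ^ (δ * D * c) * t ^ (c / τ) := by
    intro c t hc
    rw [ENNReal.mul_rpow_of_nonneg _ _ hc.le, ENNReal.mul_rpow_of_nonneg _ _ hc.le,
      ← ENNReal.rpow_mul, ← ENNReal.rpow_mul]
    congr 2; ring
  have e1 : boxAverage i' j' h₁ z ^ a ≤ C ^ a * 2 ^ (δ * D * a) * X ^ (a / τ) := by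
    rw [← hsplit _ ha]; exact ENNReal.rpow_le_rpow (hz₁ i' j' hor) ha.le
  have e2 : boxAverage i' j' h₂ z ^ b ≤ C ^ b * 2 ^ (δ * D * b) * Y ^ (b / τ) := by
    rw [← hsplit _ hb]; exact ENNReal.rpow_le_rpow (hz₂ i' j' hor) hb.le
  have e3 : (2 : ℝ≥0∞) ^ (α * i' + β * j') = 2 ^ (-(α * ((max i i' - i' : ℤ) : ℝ)
      + β * ((max j j' - j' : ℤ) : ℝ))) * 2 ^ (α * (max i i' : ℤ) + β * (max j j' : ℤ)) := by
    rw [← ENNReal.rpow_add _ _ (by simp) (by simp)]; congr 1; push_cast; ring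
  have e4 : (2 : ℝ≥0∞) ^ (δ * D * a) * 2 ^ (δ * D * b) ≤ 2 ^ (δ * (D : ℝ)) := by
    rw [← ENNReal.rpow_add _ _ (by simp) (by simp)]
    refine ENNReal.rpow_le_rpow_of_exponent_le (by norm_num) ?_
    have : 0 ≤ δ * (D : ℝ) := by positivity
    nlinarith
  have e5 : (2 : ℝ≥0∞) ^ (δ * (D : ℝ) - α * ((max i i' - i' : ℤ) : ℝ)
      - β * ((max j j' - j' : ℤ) : ℝ)) = 2 ^ (δ * (D : ℝ))
        * 2 ^ (-(α * ((max i i' - i' : ℤ) : ℝ) + β * ((max j j' - j' : ℤ) : ℝ))) := by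
    rw [← ENNReal.rpow_add _ _ (by simp) (by simp)]; congr 1; ring
  rw [boxCoefficient, e3, e5, ENNReal.rpow_add_of_nonneg _ _ ha.le hb.le]
  set P := (2 : ℝ≥0∞) ^ (-(α * ((max i i' - i' : ℤ) : ℝ) + β * ((max j j' - j' : ℤ) : ℝ)))
  set Q := (2 : ℝ≥0∞) ^ (α * (max i i' : ℤ) + β * (max j j' : ℤ))
  calc P * Q * (boxAverage i' j' h₁ z ^ a * boxAverage i' j' h₂ z ^ b)
      ≤ P * Q * (C ^ a * 2 ^ (δ * D * a) * X ^ (a / τ)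
          * (C ^ b * 2 ^ (δ * D * b) * Y ^ (b / τ))) := by
        gcongr
    _ = C ^ a * C ^ b * (Q * (X ^ (a / τ) * Y ^ (b / τ)))
          * (2 ^ (δ * D * a) * 2 ^ (δ * D * b) * P) := by ring
    _ ≤ C ^ a * C ^ b * A * (2 ^ (δ * (D : ℝ)) * P) := by gcongr

/-- At every point, the quantities attached to those boxes for which the point is good have a
bounded sum over all scales: for any two of the boxes, the quantity of each is controlled through
their join, and the product of the two bounds decays in the distance of the scales. -/
lemma exists_tsum_boxCoefficient_le (n m : ℕ) {α β δ : ℝ} (hδ : 0 < δ)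
    (hα : 2 * δ ≤ α) (hβ : 2 * δ ≤ β) :
    ∃ K : ℝ≥0∞, K ≠ ∞ ∧ ∀ {a b τ : ℝ}, 0 < a → 0 < b → a + b ≤ 1 → ∀ {C A : ℝ≥0∞},
      C ≠ ∞ → A ≠ ∞ → ∀ {h₁ h₂ : EuclideanSpace ℝ (Fin n) × EuclideanSpace ℝ (Fin m) → ℝ≥0∞}
      (z : EuclideanSpace ℝ (Fin n) × EuclideanSpace ℝ (Fin m)),
      (∀ i j : ℤ, 2 ^ (α * i + β * j) * (boxAverage i j (fun w => h₁ w ^ τ) z ^ (a / τ)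
        * boxAverage i j (fun w => h₂ w ^ τ) z ^ (b / τ)) ≤ A) →
      ∑' r : ℤ × ℤ, (goodSet τ δ C r.1 r.2 h₁ ∩ goodSet τ δ C r.1 r.2 h₂).indicator
        (boxCoefficient α β a b h₁ h₂ r.1 r.2) z ≤ K * (C ^ (a + b) * A) := by
  obtain ⟨K, hK, hsum⟩ := exists_tsum_le_of_mul_le hδ
  refine ⟨K, hK, fun {a b τ} ha hb hab {C A} hC hA {h₁ h₂} z hz => ?_⟩
  have hCA : C ^ (a + b) * A ≠ ∞ :=
    ENNReal.mul_ne_top (ENNReal.rpow_ne_top_of_nonneg (by linarith) hC) hA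
  refine hsum _ _ hCA fun r s => ?_
  by_cases hr : z ∈ goodSet τ δ C r.1 r.2 h₁ ∩ goodSet τ δ C r.1 r.2 h₂
  swap
  · simp [Set.indicator_of_notMem hr]
  by_cases hs : z ∈ goodSet τ δ C s.1 s.2 h₁ ∩ goodSet τ δ C s.1 s.2 h₂
  swap
  · simp [Set.indicator_of_notMem hs]
  rw [Set.indicator_of_mem hr, Set.indicator_of_mem hs]
  obtain ⟨i, j⟩ := r
  obtain ⟨i', j'⟩ := s
  simp only at hr hs ⊢
  have key : ∀ {e e' : ℝ}, boxCoefficient α β a b h₁ h₂ i j z ≤ C ^ (a + b) * A * 2 ^ e →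
      boxCoefficient α β a b h₁ h₂ i' j' z ≤ C ^ (a + b) * A * 2 ^ e' →
      e + e' ≤ -(δ * ((|i - i'| + |j - j'| : ℤ) : ℝ)) →
      boxCoefficient α β a b h₁ h₂ i j z * boxCoefficient α β a b h₁ h₂ i' j' z
        ≤ (C ^ (a + b) * A) ^ 2 * 2 ^ (-(δ * ((|i - i'| + |j - j'| : ℤ) : ℝ))) := by
    intro e e' he he' hle
    calc _ ≤ C ^ (a + b) * A * 2 ^ e * (C ^ (a + b) * A * 2 ^ e') := mul_le_mul' he he'
      _ = (C ^ (a + b) * A) ^ 2 * 2 ^ (e + e') := by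
          rw [ENNReal.rpow_add (x := 2) _ _ (by simp) (by simp)]; ring
      _ ≤ _ := by
          refine mul_le_mul_right (ENNReal.rpow_le_rpow_of_exponent_le (by norm_num) hle) _
  have hself : ∀ i j : ℤ, z ∈ goodSet τ δ C i j h₁ ∩ goodSet τ δ C i j h₂ →
      boxCoefficient α β a b h₁ h₂ i j z ≤ C ^ (a + b) * A * 2 ^ (0 : ℝ) := fun i j h => by
    have := boxCoefficient_le ha hb hab hδ (hz (max i i) (max j j)) h.1 h.2 (.inl le_rfl)
    simpa using this
  have hR := fun hor => boxCoefficient_le (α := α) (β := β) (i := i) (j := j) (i' := i') (j' := j')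
    ha hb hab hδ (hz _ _) hr.1 hr.2 hor
  have hS := fun hor => boxCoefficient_le (α := α) (β := β) (i := i') (j := j') (i' := i) (j' := j)
    ha hb hab hδ (hz _ _) hs.1 hs.2 hor
  -- the distance of two scales is the sum of their distances to the larger one, which are
  -- the quantities in the exponents
  have habs : ∀ x y : ℤ,
      ((|x - y| : ℤ) : ℝ) = ((max x y - x : ℤ) : ℝ) + ((max x y - y : ℤ) : ℝ) := by
    intro x y
    rw [← Int.cast_add]; congr 1
    rcases le_total x y with h | h
    · rw [abs_of_nonpos (by omega)]; omega
    · rw [abs_of_nonneg (by omega)]; omega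
  have hnn : ∀ x y : ℤ, (0 : ℝ) ≤ ((max x y - x : ℤ) : ℝ) ∧ (0 : ℝ) ≤ ((max x y - y : ℤ) : ℝ) := by
    intro x y
    exact ⟨by exact_mod_cast (by omega : 0 ≤ max x y - x),
      by exact_mod_cast (by omega : 0 ≤ max x y - y)⟩
  have hi := hnn i i'
  have hj := hnn j j'
  by_cases h1 : i' ≤ i ∨ j' ≤ j
  · by_cases h2 : i ≤ i' ∨ j ≤ j'
    · refine key (hS h2) (hR h1) ?_
      rw [max_comm i' i, max_comm j' j]
      rw [Int.cast_add, Int.cast_add, Int.cast_add, habs i i', habs j j']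
      nlinarith
    -- the box of scales `(i, j)` is its own join with itself, so its bound has no gain
    · refine key (hself i j hr) (hR h1) ?_
      have e1 : max i i' - i = 0 := by omega
      have e2 : max j j' - j = 0 := by omega
      rw [Int.cast_add (|i - i'|), habs i i', habs j j', e1, e2]
      simp only [Int.cast_zero, add_zero, zero_add, mul_zero]
      nlinarith
  · have h2 : i ≤ i' ∨ j ≤ j' := by omega
    refine key (hS h2) (hself i' j' hs) ?_
    have e1 : max i i' - i' = 0 := by omega
    have e2 : max j j' - j' = 0 := by omega
    rw [max_comm i' i, max_comm j' j, Int.cast_add (|i - i'|), habs i i', habs j j', e1, e2]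
    simp only [Int.cast_zero, add_zero, mul_zero]
    nlinarith

end Coefficients

/-! ### The bilinear estimate -/

section Bilinear

variable {n m : ℕ}

lemma lintegral_eq_tsum_dyadicCell (i j : ℤ)
    (g : EuclideanSpace ℝ (Fin n) × EuclideanSpace ℝ (Fin m) → ℝ≥0∞)
    (μ : Measure (EuclideanSpace ℝ (Fin n) × EuclideanSpace ℝ (Fin m))) :
    ∫⁻ z, g z ∂μ = ∑' r : (Fin n → ℤ) × (Fin m → ℤ),
      ∫⁻ z in dyadicCell i r.1 ×ˢ dyadicCell j r.2, g z ∂μ := by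
  have hU : (⋃ r : (Fin n → ℤ) × (Fin m → ℤ), dyadicCell i r.1 ×ˢ dyadicCell j r.2)
      = (Set.univ : Set (EuclideanSpace ℝ (Fin n) × EuclideanSpace ℝ (Fin m))) := by
    refine Set.eq_univ_of_forall fun z => Set.mem_iUnion.mpr
      ⟨(dyadicIndex i z.1, dyadicIndex j z.2), ?_, ?_⟩
    · exact self_mem_dyadicCell i z.1
    · exact self_mem_dyadicCell j z.2
  rw [← setLIntegral_univ, ← hU, lintegral_iUnion]
  · exact fun r => (measurableSet_dyadicCell i r.1).prod (measurableSet_dyadicCell j r.2)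
  · intro r s hrs
    refine Set.disjoint_left.mpr fun z hz hz' => hrs (Prod.ext ?_ ?_)
    · exact (show dyadicIndex i z.1 = r.1 from hz.1).symm.trans hz'.1
    · exact (show dyadicIndex j z.2 = r.2 from hz.2).symm.trans hz'.2

/-- Against a function that is constant on cells, `g` may be replaced by its averages over dilated
cells, restricted to a set that contains at least half of every cell. -/
lemma lintegral_mul_boxIndex_le (i j : ℤ)
    {E : Set (EuclideanSpace ℝ (Fin n) × EuclideanSpace ℝ (Fin m))} (hE : MeasurableSet E)
    (hEc : ∀ k l, volume ((dyadicCell i k ×ˢ dyadicCell j l) \ E)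
      ≤ 2⁻¹ * (volume (dyadicCell i k) * volume (dyadicCell j l)))
    {g : EuclideanSpace ℝ (Fin n) × EuclideanSpace ℝ (Fin m) → ℝ≥0∞} (hg : Measurable g)
    (φ : (Fin n → ℤ) → (Fin m → ℤ) → ℝ≥0∞) :
    ∫⁻ z, g z * φ (dyadicIndex i z.1) (dyadicIndex j z.2) ≤ 2 * (3 ^ n * 3 ^ m)
      * ∫⁻ z in E, boxAverage i j g z * φ (dyadicIndex i z.1) (dyadicIndex j z.2) := by
  rw [lintegral_eq_tsum_dyadicCell i j, lintegral_eq_tsum_dyadicCell i j, ← ENNReal.tsum_mul_left]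
  refine ENNReal.tsum_le_tsum fun r => ?_
  obtain ⟨k, l⟩ := r
  simp only
  have hR : MeasurableSet ((dyadicCell i k : Set (EuclideanSpace ℝ (Fin n))) ×ˢ
      (dyadicCell j l : Set (EuclideanSpace ℝ (Fin m)))) :=
    (measurableSet_dyadicCell i k).prod (measurableSet_dyadicCell j l)
  set R := (dyadicCell i k : Set (EuclideanSpace ℝ (Fin n))) ×ˢ
      (dyadicCell j l : Set (EuclideanSpace ℝ (Fin m))) with hRdef
  set X := ∫⁻ w, g w ∂(cubeMeasure i k).prod (cubeMeasure j l) with hX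
  have hvR : volume R = volume (dyadicCell i k) * volume (dyadicCell j l) := by
    rw [Measure.volume_eq_prod, Measure.prod_prod]
  have hvRt : volume R ≠ ∞ := by
    rw [hvR]; exact ENNReal.mul_ne_top (volume_dyadicCell_ne_top i k) (volume_dyadicCell_ne_top j l)
  have hhalf : volume R ≤ 2 * volume (R ∩ E) := by
    have h1 : volume R ≤ volume (R ∩ E) + 2⁻¹ * volume R := by
      rw [← measure_inter_add_sdiff R hE]
      refine add_le_add le_rfl ?_
      rw [measure_inter_add_sdiff R hE, hvR]
      exact hEc k l
    have h2 : 2⁻¹ * volume R ≤ volume (R ∩ E) := by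
      have h3 : 2⁻¹ * volume R + 2⁻¹ * volume R ≤ volume (R ∩ E) + 2⁻¹ * volume R := by
        rwa [← add_mul, ENNReal.inv_two_add_inv_two, one_mul]
      exact (ENNReal.add_le_add_iff_right (by finiteness)).mp h3
    calc volume R = 2 * (2⁻¹ * volume R) := by
          rw [← mul_assoc, ENNReal.mul_inv_cancel (by simp) (by simp), one_mul]
      _ ≤ _ := mul_le_mul_right h2 _
  have hL : ∫⁻ z in R, g z * φ (dyadicIndex i z.1) (dyadicIndex j z.2)
      ≤ 3 ^ n * 3 ^ m * volume R * X * φ k l := by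
    calc ∫⁻ z in R, g z * φ (dyadicIndex i z.1) (dyadicIndex j z.2)
        = ∫⁻ z in R, g z * φ k l := by
          refine setLIntegral_congr_fun hR fun z hz => ?_
          simp only [show dyadicIndex i z.1 = k from hz.1, show dyadicIndex j z.2 = l from hz.2]
      _ ≤ ∫⁻ z in dilatedCube i k ×ˢ dilatedCube j l, g z * φ k l :=
          lintegral_mono_set (Set.prod_mono (dyadicCell_subset_dilatedCube i k)
            (dyadicCell_subset_dilatedCube j l))
      _ = volume (dilatedCube i k) * volume (dilatedCube j l)
            * ∫⁻ w, g w * φ k l ∂(cubeMeasure i k).prod (cubeMeasure j l) :=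
          setLIntegral_dilatedCube_prod i j k l _
      _ = 3 ^ n * 3 ^ m * volume R * X * φ k l := by
          rw [lintegral_mul_const _ hg, volume_dilatedCube_eq, volume_dilatedCube_eq, hvR]; ring
  have hRr : ∫⁻ z in R, boxAverage i j g z * φ (dyadicIndex i z.1) (dyadicIndex j z.2)
      ∂volume.restrict E = volume (R ∩ E) * (X * φ k l) := by
    rw [Measure.restrict_restrict hR]
    rw [mul_comm, ← setLIntegral_const]
    refine setLIntegral_congr_fun (hR.inter hE) fun z hz => ?_
    simp only [boxAverage, show dyadicIndex i z.1 = k from hz.1.1,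
      show dyadicIndex j z.2 = l from hz.1.2, hX]
  rw [hRr]
  refine hL.trans ?_
  calc 3 ^ n * 3 ^ m * volume R * X * φ k l ≤ 3 ^ n * 3 ^ m * (2 * volume (R ∩ E)) * X * φ k l := by
        gcongr
    _ = _ := by ring

lemma boxAverage_mul_le {a b : ℝ} (hab : a.HolderConjugate b) (i j : ℤ)
    {F U : EuclideanSpace ℝ (Fin n) × EuclideanSpace ℝ (Fin m) → ℝ≥0∞} (hF : Measurable F)
    (hU : Measurable U) (z : EuclideanSpace ℝ (Fin n) × EuclideanSpace ℝ (Fin m)) :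
    boxAverage i j (fun w => F w * U w) z
      ≤ boxAverage i j (fun w => F w ^ a) z ^ (1 / a)
        * boxAverage i j (fun w => U w ^ b) z ^ (1 / b) :=
  ENNReal.lintegral_mul_le_Lp_mul_Lq _ hab hF.aemeasurable hU.aemeasurable

/-- As `q * τ > q`, the exponent conjugate to `q * τ` is smaller than `p`, so that the strong
maximal theorem applies to the corresponding power of `F`. -/
lemma exists_lintegral_strongMaximal_conjExponent_le (n m : ℕ) {p q τ : ℝ}
    (hpq : p.HolderConjugate q) (hτ : 1 < τ) :
    ∃ K : ℝ≥0∞, K ≠ ∞ ∧ ∀ F : EuclideanSpace ℝ (Fin n) × EuclideanSpace ℝ (Fin m) → ℝ≥0∞,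
      Measurable F → (∫⁻ z, (strongMaximal (fun w => F w ^ (q * τ).conjExponent) z
        ^ (1 / (q * τ).conjExponent)) ^ p) ^ (1 / p) ≤ K * (∫⁻ z, F z ^ p) ^ (1 / p) := by
  have hp : 0 < p := hpq.pos
  have hq : 1 < q := hpq.symm.lt
  have hs : 1 < q * τ := by nlinarith
  have hc := Real.HolderConjugate.conjExponent hs
  set a := (q * τ).conjExponent with ha
  have ha0 : 0 < a := hc.symm.pos
  have hap : 1 < p / a := by
    rw [one_lt_div ha0]
    have h1 := hc.inv_add_inv_eq_one
    have h2 := hpq.inv_add_inv_eq_one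
    have h3 : (q * τ)⁻¹ < q⁻¹ := inv_strictAnti₀ (by linarith) (by nlinarith)
    exact (inv_lt_inv₀ hp ha0).mp (by linarith)
  obtain ⟨K, hK, h⟩ := exists_lintegral_strongMaximal_rpow_le n m hap
  refine ⟨K ^ (1 / p), ENNReal.rpow_ne_top_of_nonneg (by positivity) hK, fun F hF => ?_⟩
  rw [← ENNReal.mul_rpow_of_nonneg _ _ (by positivity)]
  refine ENNReal.rpow_le_rpow ?_ (by positivity)
  have := h _ (hF.pow_const a)
  simp only [← ENNReal.rpow_mul] at this ⊢
  rw [mul_div_cancel₀ _ ha0.ne'] at this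
  rwa [one_div_mul_eq_div]

/-- The discretised bilinear form is bounded on `L^p × L^q` by the bumped characteristic. -/
lemma exists_tsum_lintegral_boxAverage_le (n m : ℕ) {α β p q τ : ℝ} (hα : 0 < α) (hβ : 0 < β)
    (hpq : p.HolderConjugate q) (hτ : 1 < τ) :
    ∃ K : ℝ≥0∞, K ≠ ∞ ∧ ∀ {A : ℝ≥0∞}, A ≠ ∞ →
      ∀ {U V F G : EuclideanSpace ℝ (Fin n) × EuclideanSpace ℝ (Fin m) → ℝ≥0∞},
      Measurable U → Measurable V → Measurable F → Measurable G →
      (∀ (i j : ℤ) (z : EuclideanSpace ℝ (Fin n) × EuclideanSpace ℝ (Fin m)),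
        2 ^ (α * i + β * j) * (boxAverage i j (fun w => U w ^ (q * τ * τ)) z ^ (1 / (q * τ * τ))
          * boxAverage i j (fun w => V w ^ (p * τ * τ)) z ^ (1 / (p * τ * τ))) ≤ A) →
      ∑' r : ℤ × ℤ, ∫⁻ z, G z * V z * (2 ^ (α * r.1 + β * r.2)
          * boxAverage r.1 r.2 (fun w => F w * U w) z)
        ≤ K * A * ((∫⁻ z, F z ^ p) ^ (1 / p) * (∫⁻ z, G z ^ q) ^ (1 / q)) := by
  have hp1 : 1 < p := hpq.lt
  have hq1 : 1 < q := hpq.symm.lt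
  have hs : 1 < q * τ := by nlinarith
  have ht : 1 < p * τ := by nlinarith
  have hs0 : 0 < q * τ := by linarith
  have ht0 : 0 < p * τ := by linarith
  have hτ0 : 0 < τ := by linarith
  have hab : 1 / (q * τ) + 1 / (p * τ) ≤ 1 := by
    have h2 := hpq.inv_add_inv_eq_one
    have h3 : 1 / (q * τ) ≤ q⁻¹ := by
      rw [one_div]; exact inv_anti₀ (by linarith) (by nlinarith)
    have h4 : 1 / (p * τ) ≤ p⁻¹ := by
      rw [one_div]; exact inv_anti₀ (by linarith) (by nlinarith)
    linarith
  -- half of the decay of the kernel pays for the growth allowed in the good sets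
  set δ := min α β / 2 with hδdef
  have hδ : 0 < δ := half_pos (lt_min hα hβ)
  have hδα : 2 * δ ≤ α := by rw [hδdef]; linarith [min_le_left α β]
  have hδβ : 2 * δ ≤ β := by rw [hδdef]; linarith [min_le_right α β]
  obtain ⟨C, hC, hgood⟩ := exists_volume_diff_goodSet_le n m hτ hδ
  obtain ⟨K₀, hK₀, hsum⟩ := exists_tsum_boxCoefficient_le n m hδ hδα hδβ
  obtain ⟨K₁, hK₁, hM₁⟩ := exists_lintegral_strongMaximal_conjExponent_le n m hpq hτ
  obtain ⟨K₂, hK₂, hM₂⟩ := exists_lintegral_strongMaximal_conjExponent_le n m hpq.symm hτ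
  have hCab : C ^ (1 / (q * τ) + 1 / (p * τ)) ≠ ∞ :=
    ENNReal.rpow_ne_top_of_nonneg (by positivity) hC
  refine ⟨2 * (3 ^ n * 3 ^ m) * (K₀ * C ^ (1 / (q * τ) + 1 / (p * τ))) * (K₁ * K₂), by finiteness,
    fun {A} hA {U V F G} hU hV hF hG hUV => ?_⟩
  have hcs := Real.HolderConjugate.conjExponent hs
  have hct := Real.HolderConjugate.conjExponent ht
  set a := (q * τ).conjExponent with ha
  set b := (p * τ).conjExponent with hb
  have ha0 : 0 < a := hcs.symm.pos
  have hb0 : 0 < b := hct.symm.pos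
  set h₁ : EuclideanSpace ℝ (Fin n) × EuclideanSpace ℝ (Fin m) → ℝ≥0∞ := fun w => U w ^ (q * τ)
  set h₂ : EuclideanSpace ℝ (Fin n) × EuclideanSpace ℝ (Fin m) → ℝ≥0∞ := fun w => V w ^ (p * τ)
  have hh₁ : Measurable h₁ := hU.pow_const _
  have hh₂ : Measurable h₂ := hV.pow_const _
  let E : ℤ × ℤ → Set (EuclideanSpace ℝ (Fin n) × EuclideanSpace ℝ (Fin m)) := fun r =>
    goodSet τ δ C r.1 r.2 h₁ ∩ goodSet τ δ C r.1 r.2 h₂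
  have hE : ∀ r, MeasurableSet (E r) := fun r =>
    (measurableSet_goodSet _ _ _ _ _ _).inter (measurableSet_goodSet _ _ _ _ _ _)
  have hEc : ∀ r k l, volume ((dyadicCell r.1 k ×ˢ dyadicCell r.2 l) \ E r)
      ≤ 2⁻¹ * (volume (dyadicCell r.1 k) * volume (dyadicCell r.2 l)) := fun r k l => by
    rw [Set.sdiff_inter]
    refine (measure_union_le _ _).trans ((add_le_add (hgood h₁ hh₁ r.1 r.2 k l)
      (hgood h₂ hh₂ r.1 r.2 k l)).trans_eq ?_)
    rw [← add_mul]
    congr 1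
    rw [← two_mul, show (4 : ℝ≥0∞) = 2 * 2 by norm_num, ENNReal.mul_inv (by simp) (by simp),
      ← mul_assoc, ENNReal.mul_inv_cancel (by simp) (by simp), one_mul]
  have hcoef : ∀ z, ∑' r : ℤ × ℤ, (E r).indicator
      (boxCoefficient α β (1 / (q * τ)) (1 / (p * τ)) h₁ h₂ r.1 r.2) z
      ≤ K₀ * (C ^ (1 / (q * τ) + 1 / (p * τ)) * A) := fun z => by
    refine hsum (by positivity) (by positivity) hab hC hA z fun i j => ?_
    have := hUV i j z
    simp only [h₁, h₂, ← ENNReal.rpow_mul, div_div]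
    exact this
  set MF : EuclideanSpace ℝ (Fin n) × EuclideanSpace ℝ (Fin m) → ℝ≥0∞ := fun z =>
    strongMaximal (fun w => F w ^ a) z ^ (1 / a) with hMF
  set MG : EuclideanSpace ℝ (Fin n) × EuclideanSpace ℝ (Fin m) → ℝ≥0∞ := fun z =>
    strongMaximal (fun w => G w ^ b) z ^ (1 / b) with hMG
  have hMFm : Measurable MF := (measurable_strongMaximal _).pow_const _
  have hMGm : Measurable MG := (measurable_strongMaximal _).pow_const _
  have hcoefm : ∀ r : ℤ × ℤ,
      Measurable (boxCoefficient α β (1 / (q * τ)) (1 / (p * τ)) h₁ h₂ r.1 r.2) := fun r =>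
    (((measurable_boxAverage _ _ _).pow_const _).mul
      ((measurable_boxAverage _ _ _).pow_const _)).const_mul _
  have hpoint : ∀ (r : ℤ × ℤ) z, boxAverage r.1 r.2 (fun w => G w * V w) z
      * (2 ^ (α * r.1 + β * r.2) * boxAverage r.1 r.2 (fun w => F w * U w) z)
      ≤ boxCoefficient α β (1 / (q * τ)) (1 / (p * τ)) h₁ h₂ r.1 r.2 z * (MF z * MG z) := by
    intro r z
    have e1 : boxAverage r.1 r.2 (fun w => F w * U w) z
        ≤ MF z * boxAverage r.1 r.2 h₁ z ^ (1 / (q * τ)) := by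
      refine (boxAverage_mul_le hcs.symm r.1 r.2 hF hU z).trans ?_
      gcongr
      exact ENNReal.rpow_le_rpow (boxAverage_le_strongMaximal _ _ _ _) (by positivity)
    have e2 : boxAverage r.1 r.2 (fun w => G w * V w) z
        ≤ MG z * boxAverage r.1 r.2 h₂ z ^ (1 / (p * τ)) := by
      refine (boxAverage_mul_le hct.symm r.1 r.2 hG hV z).trans ?_
      gcongr
      exact ENNReal.rpow_le_rpow (boxAverage_le_strongMaximal _ _ _ _) (by positivity)
    rw [boxCoefficient]
    calc _ ≤ MG z * boxAverage r.1 r.2 h₂ z ^ (1 / (p * τ)) * (2 ^ (α * r.1 + β * r.2)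
            * (MF z * boxAverage r.1 r.2 h₁ z ^ (1 / (q * τ)))) := by gcongr
      _ = _ := by ring
  calc ∑' r : ℤ × ℤ, ∫⁻ z, G z * V z * (2 ^ (α * r.1 + β * r.2)
          * boxAverage r.1 r.2 (fun w => F w * U w) z)
      ≤ ∑' r : ℤ × ℤ, 2 * (3 ^ n * 3 ^ m) * ∫⁻ z, (E r).indicator
          (boxCoefficient α β (1 / (q * τ)) (1 / (p * τ)) h₁ h₂ r.1 r.2) z * (MF z * MG z) := by
        refine ENNReal.tsum_le_tsum fun r => ?_
        refine (lintegral_mul_boxIndex_le r.1 r.2 (hE r) (hEc r) (hG.mul hV)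
          fun k l => 2 ^ (α * r.1 + β * r.2) *
            ∫⁻ w, F w * U w ∂(cubeMeasure r.1 k).prod (cubeMeasure r.2 l)).trans ?_
        refine mul_le_mul_right ?_ _
        rw [← lintegral_indicator (hE r)]
        refine lintegral_mono fun z => ?_
        by_cases hz : z ∈ E r
        · simp only [Set.indicator_of_mem hz]; exact hpoint r z
        · simp only [Set.indicator_of_notMem hz, zero_mul, le_refl]
    _ = 2 * (3 ^ n * 3 ^ m) * ∫⁻ z, (∑' r : ℤ × ℤ, (E r).indicator
          (boxCoefficient α β (1 / (q * τ)) (1 / (p * τ)) h₁ h₂ r.1 r.2) z) * (MF z * MG z) := by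
        rw [ENNReal.tsum_mul_left, ← lintegral_tsum]
        · simp only [ENNReal.tsum_mul_right]
        · exact fun r => (((hcoefm r).indicator (hE r)).mul (hMFm.mul hMGm)).aemeasurable
    _ ≤ 2 * (3 ^ n * 3 ^ m) * ∫⁻ z, K₀ * (C ^ (1 / (q * τ) + 1 / (p * τ)) * A) * (MF z * MG z) := by
        gcongr with z; exact hcoef z
    _ = 2 * (3 ^ n * 3 ^ m) * (K₀ * (C ^ (1 / (q * τ) + 1 / (p * τ)) * A) * ∫⁻ z, MF z * MG z) := by
        rw [lintegral_const_mul' _ _ (by finiteness)]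
    _ ≤ 2 * (3 ^ n * 3 ^ m) * (K₀ * (C ^ (1 / (q * τ) + 1 / (p * τ)) * A)
          * ((K₁ * (∫⁻ z, F z ^ p) ^ (1 / p)) * (K₂ * (∫⁻ z, G z ^ q) ^ (1 / q)))) := by
        refine mul_le_mul_right (mul_le_mul_right ?_ _) _
        refine (ENNReal.lintegral_mul_le_Lp_mul_Lq _ hpq hMFm.aemeasurable
          hMGm.aemeasurable).trans ?_
        exact mul_le_mul' (hM₁ F hF) (hM₂ G hG)
    _ = _ := by ring

end Bilinear

/-! ### From the bilinear estimate to a norm inequality -/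

/-- If `H` pairs boundedly with `L^q`, then `H` belongs to `L^p`; no finiteness of `H` is assumed,
and the estimate is obtained by testing with powers of truncations of `H`. -/
lemma lintegral_rpow_le_of_forall_lintegral_mul_le {Ω : Type*} [MeasurableSpace Ω] {μ : Measure Ω}
    [SigmaFinite μ] {p q : ℝ} (hpq : p.HolderConjugate q) {H : Ω → ℝ≥0∞} (hH : Measurable H)
    {B : ℝ≥0∞} (h : ∀ G : Ω → ℝ≥0∞, Measurable G →
      ∫⁻ z, G z * H z ∂μ ≤ B * (∫⁻ z, G z ^ q ∂μ) ^ (1 / q)) :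
    (∫⁻ z, H z ^ p ∂μ) ^ (1 / p) ≤ B := by
  have hp := hpq.pos
  have hq := hpq.symm.pos
  let T : ℕ → Ω → ℝ≥0∞ := fun N => (spanningSets μ N).indicator fun z => min (H z) N
  have hT : ∀ N, Measurable (T N) := fun N =>
    (hH.min measurable_const).indicator (measurableSet_spanningSets μ N)
  have hTH : ∀ N z, T N z ≤ H z := fun N z =>
    Set.indicator_apply_le' (fun _ => min_le_left _ _) fun _ => zero_le
  have hmono : Monotone fun N z => T N z ^ p := by
    intro N M hNM z
    refine ENNReal.rpow_le_rpow ?_ hp.le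
    refine Set.indicator_le_indicator_of_subset (monotone_spanningSets μ hNM) (fun _ => zero_le) z
      |>.trans ?_
    refine Set.indicator_le_indicator ?_
    exact min_le_min le_rfl (by exact_mod_cast hNM)
  have hsup : ∀ z, H z ^ p ≤ ⨆ N, T N z ^ p := by
    intro z
    rw [← ENNReal.le_rpow_inv_iff hp]
    refine ENNReal.le_of_forall_nnreal_lt fun r hr => ?_
    rw [ENNReal.le_rpow_inv_iff hp]
    obtain ⟨N₁, hN₁⟩ := exists_nat_ge r
    obtain ⟨N₂, hN₂⟩ := Set.mem_iUnion.mp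
      ((iUnion_spanningSets μ).symm ▸ Set.mem_univ z : z ∈ ⋃ N, spanningSets μ N)
    refine le_trans ?_ (le_iSup (fun N => T N z ^ p) (max N₁ N₂))
    refine ENNReal.rpow_le_rpow ?_ hp.le
    simp only [T]
    rw [Set.indicator_of_mem (monotone_spanningSets μ (le_max_right _ _) hN₂)]
    refine le_min hr.le ?_
    calc (r : ℝ≥0∞) ≤ (N₁ : ℝ≥0∞) := by exact_mod_cast hN₁
      _ ≤ _ := by exact_mod_cast le_max_left _ _
  have hN : ∀ N, ∫⁻ z, T N z ^ p ∂μ ≤ B ^ p := by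
    intro N
    set X := ∫⁻ z, T N z ^ p ∂μ with hX
    have hXt : X ≠ ∞ := by
      refine ne_top_of_le_ne_top (b := (N : ℝ≥0∞) ^ p * μ (spanningSets μ N)) ?_ ?_
      · exact ENNReal.mul_ne_top (ENNReal.rpow_ne_top_of_nonneg hp.le (by simp))
          (measure_spanningSets_lt_top μ N).ne
      · rw [← lintegral_indicator_const (measurableSet_spanningSets μ N)]
        refine lintegral_mono fun z => ?_
        simp only [T]
        by_cases hz : z ∈ spanningSets μ N
        · simp only [Set.indicator_of_mem hz]
          exact ENNReal.rpow_le_rpow (min_le_right _ _) hp.le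
        · simp [Set.indicator_of_notMem hz, hp]
    have h1 := h (fun z => T N z ^ (p - 1)) ((hT N).pow_const _)
    have hpow : ∀ z, (T N z ^ (p - 1)) ^ q = T N z ^ p := fun z => by
      rw [← ENNReal.rpow_mul, hpq.sub_one_mul_conj]
    simp only [hpow] at h1
    have h2 : X ≤ B * X ^ (1 / q) := by
      refine le_trans (lintegral_mono fun z => ?_) h1
      have : T N z ^ p = T N z ^ (p - 1) * T N z := by
        nth_rw 3 [← ENNReal.rpow_one (T N z)]
        rw [← ENNReal.rpow_add_of_nonneg _ _ (by linarith [hpq.lt]) zero_le_one, sub_add_cancel]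
      change T N z ^ p ≤ _
      rw [this]
      gcongr
      exact hTH N z
    rcases eq_or_ne X 0 with hX0 | hX0
    · rw [hX0]; exact zero_le
    have h3 : X ^ (1 / p) * X ^ (1 / q) = X := by
      rw [← ENNReal.rpow_add _ _ hX0 hXt]
      have := hpq.inv_add_inv_eq_one
      rw [one_div, one_div, this, ENNReal.rpow_one]
    have h4 : X ^ (1 / p) ≤ B := by
      refine (ENNReal.mul_le_mul_iff_left (c := X ^ (1 / q)) (by simp [hX0, hXt])
        (ENNReal.rpow_ne_top_of_nonneg (by positivity) hXt)).mp ?_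
      rw [h3]
      exact h2
    calc X = (X ^ (1 / p)) ^ p := (rpow_one_div_rpow hp X).symm
      _ ≤ B ^ p := ENNReal.rpow_le_rpow h4 hp.le
  rw [one_div, ENNReal.rpow_inv_le_iff hp]
  calc ∫⁻ z, H z ^ p ∂μ ≤ ∫⁻ z, ⨆ N, T N z ^ p ∂μ := lintegral_mono hsup
    _ = ⨆ N, ∫⁻ z, T N z ^ p ∂μ := lintegral_iSup (fun N => (hT N).pow_const p) hmono
    _ ≤ B ^ p := iSup_le hN

section Operator

variable {n m : ℕ}

/-- The dyadic majorant of the strong fractional integral of `h`: a pair of scales `(i, j)`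
contributes its box average with the weight `2 ^ (α * i + β * j)`. -/
noncomputable def boxPotential (α β : ℝ)
    (h : EuclideanSpace ℝ (Fin n) × EuclideanSpace ℝ (Fin m) → ℝ≥0∞)
    (z : EuclideanSpace ℝ (Fin n) × EuclideanSpace ℝ (Fin m)) : ℝ≥0∞ :=
  ∑' r : ℤ × ℤ, 2 ^ (α * r.1 + β * r.2) * boxAverage r.1 r.2 h z

lemma measurable_boxPotential (α β : ℝ)
    (h : EuclideanSpace ℝ (Fin n) × EuclideanSpace ℝ (Fin m) → ℝ≥0∞) :
    Measurable (boxPotential α β h) := by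
  unfold boxPotential
  exact Measurable.tsum fun r => (measurable_boxAverage r.1 r.2 h).const_mul _

lemma ofReal_one_div_norm_rpow_le {γ : ℝ} (hγ : 0 < γ) (x u : EuclideanSpace ℝ (Fin n)) :
    ENNReal.ofReal ((1 / ‖x - u‖) ^ γ) ≤ 2 ^ γ * ∑' i : ℤ,
      (dilatedCube i (dyadicIndex i x)).indicator (fun _ => (2 : ℝ≥0∞) ^ (-(γ * i))) u := by
  rcases eq_or_ne x u with rfl | hxu
  · simp [hγ.ne']
  have hr : 0 < ‖x - u‖ := norm_pos_iff.mpr (sub_ne_zero.mpr hxu)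
  obtain ⟨i, hi1, hi2⟩ := exists_mem_Ioc_zpow hr (one_lt_two)
  refine le_trans ?_ (mul_le_mul_right (ENNReal.le_tsum (i + 1)) _)
  rw [Set.indicator_of_mem (mem_dilatedCube_of_norm_sub_le hi2),
    ← ENNReal.rpow_add _ _ (by simp) (by simp)]
  have h1 : (1 / ‖x - u‖) ^ γ ≤ (2 : ℝ) ^ (γ + -(γ * ((i + 1 : ℤ) : ℝ))) := by
    have : (2 : ℝ) ^ (γ + -(γ * ((i + 1 : ℤ) : ℝ))) = (1 / (2 : ℝ) ^ i) ^ γ := by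
      rw [one_div, ← zpow_neg, ← Real.rpow_intCast, ← Real.rpow_mul (by norm_num)]
      congr 1; push_cast; ring
    rw [this]
    exact Real.rpow_le_rpow (by positivity) (one_div_le_one_div_of_le (by positivity) hi1.le) hγ.le
  refine (ENNReal.ofReal_le_ofReal h1).trans_eq ?_
  rw [← ENNReal.ofReal_rpow_of_pos (by norm_num)]
  simp

lemma lintegral_mul_strongKernel_le {α β : ℝ} (hα : α < n) (hβ : β < m)
    {h : EuclideanSpace ℝ (Fin n) × EuclideanSpace ℝ (Fin m) → ℝ≥0∞} (hh : Measurable h)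
    (z : EuclideanSpace ℝ (Fin n) × EuclideanSpace ℝ (Fin m)) :
    ∫⁻ w, h w * ENNReal.ofReal (strongKernel α β z w)
      ≤ 2 ^ (n - α) * 2 ^ (m - β) * (3 ^ n * 3 ^ m) * boxPotential α β h z := by
  have hγ₁ : 0 < (n : ℝ) - α := by linarith
  have hγ₂ : 0 < (m : ℝ) - β := by linarith
  have hbox : ∀ r : ℤ × ℤ, ∫⁻ w in dilatedCube r.1 (dyadicIndex r.1 z.1) ×ˢ
      dilatedCube r.2 (dyadicIndex r.2 z.2),
        h w * (2 ^ (-((n - α) * r.1)) * 2 ^ (-((m - β) * r.2)))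
      = 3 ^ n * 3 ^ m * (2 ^ (α * r.1 + β * r.2) * boxAverage r.1 r.2 h z) := fun r => by
    rw [lintegral_mul_const _ hh, setLIntegral_dilatedCube_prod, volume_dilatedCube,
      volume_dilatedCube, mul_pow, mul_pow, ← ENNReal.rpow_mul_natCast, ← ENNReal.rpow_mul_natCast,
      boxAverage]
    have e : (2 : ℝ≥0∞) ^ (α * r.1 + β * r.2) = 2 ^ ((r.1 : ℝ) * n) * 2 ^ ((r.2 : ℝ) * m)
        * (2 ^ (-((n - α) * r.1)) * 2 ^ (-((m - β) * r.2))) := by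
      simp only [← ENNReal.rpow_add (x := 2) _ _ (by simp) (by simp)]
      congr 1; ring
    rw [e]; ring
  have hpt : ∀ w, h w * ENNReal.ofReal (strongKernel α β z w) ≤ 2 ^ (n - α) * 2 ^ (m - β) *
      ∑' r : ℤ × ℤ, (dilatedCube r.1 (dyadicIndex r.1 z.1) ×ˢ
        dilatedCube r.2 (dyadicIndex r.2 z.2)).indicator
        (fun w => h w * (2 ^ (-((n - α) * r.1)) * 2 ^ (-((m - β) * r.2)))) w := by
    intro w
    have e1 := ofReal_one_div_norm_rpow_le hγ₁ z.1 w.1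
    have e2 := ofReal_one_div_norm_rpow_le hγ₂ z.2 w.2
    rw [strongKernel, ENNReal.ofReal_mul (by positivity)]
    calc _ ≤ h w * ((2 ^ (n - α) * _) * (2 ^ (m - β) * _)) := mul_le_mul_right (mul_le_mul' e1 e2) _
      _ = 2 ^ (n - α) * 2 ^ (m - β) * (h w *
            ((∑' i : ℤ, (dilatedCube i (dyadicIndex i z.1)).indicator
              (fun _ => (2 : ℝ≥0∞) ^ (-((n - α) * i))) w.1) *
            (∑' i : ℤ, (dilatedCube i (dyadicIndex i z.2)).indicator
            (fun _ => (2 : ℝ≥0∞) ^ (-((m - β) * i))) w.2))) := by ring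
      _ = _ := by
        congr 1
        rw [← ENNReal.tsum_mul_right, ENNReal.tsum_prod', ← ENNReal.tsum_mul_left]
        congr 1 with i
        rw [← ENNReal.tsum_mul_left, ← ENNReal.tsum_mul_left]
        congr 1 with j
        by_cases h1 : w.1 ∈ dilatedCube i (dyadicIndex i z.1)
        · by_cases h2 : w.2 ∈ dilatedCube j (dyadicIndex j z.2)
          · rw [Set.indicator_of_mem h1, Set.indicator_of_mem h2,
              Set.indicator_of_mem (Set.mk_mem_prod h1 h2)]
          · have h3 : w ∉ dilatedCube i (dyadicIndex i z.1) ×ˢ dilatedCube j (dyadicIndex j z.2) :=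
              fun hw => h2 hw.2
            rw [Set.indicator_of_notMem h2, Set.indicator_of_notMem h3]; simp
        · have h3 : w ∉ dilatedCube i (dyadicIndex i z.1) ×ˢ dilatedCube j (dyadicIndex j z.2) :=
            fun hw => h1 hw.1
          rw [Set.indicator_of_notMem h1, Set.indicator_of_notMem h3]; simp
  have hS : ∀ r : ℤ × ℤ, MeasurableSet (dilatedCube r.1 (dyadicIndex r.1 z.1) ×ˢ
        dilatedCube r.2 (dyadicIndex r.2 z.2)) := fun r =>
    (measurableSet_dilatedCube _ _).prod (measurableSet_dilatedCube _ _)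
  refine (lintegral_mono hpt).trans (le_of_eq ?_)
  rw [lintegral_const_mul' _ _ (by finiteness), lintegral_tsum]
  · have hterm : ∀ r : ℤ × ℤ, _ = _ := fun r => (lintegral_indicator (hS r) _).trans (hbox r)
    rw [tsum_congr hterm, ENNReal.tsum_mul_left, ← mul_assoc, boxPotential]
  · exact fun r => ((hh.mul_const _).indicator (hS r)).aemeasurable

/-- The bump condition on dilated dyadic boxes, with the powers of the volumes absorbed in the
averages. -/
lemma two_rpow_mul_boxAverage_le_bumpChar {α β p τ : ℝ} (hα : 0 < α) (hαn : α < n) (hβ : 0 < β)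
    (hβm : β < m) (hp : 1 < p) (hτ : 1 < τ)
    (ω σ : EuclideanSpace ℝ (Fin n) × EuclideanSpace ℝ (Fin m) → ℝ≥0∞) (i j : ℤ)
    (z : EuclideanSpace ℝ (Fin n) × EuclideanSpace ℝ (Fin m)) :
    2 ^ (α * i + β * j)
      * (boxAverage i j (fun w => (1 / σ w) ^ (p.conjExponent * τ * τ)) z
          ^ (1 / (p.conjExponent * τ * τ))
        * boxAverage i j (fun w => ω w ^ (p * τ * τ)) z ^ (1 / (p * τ * τ)))
      ≤ bumpChar α β p (τ * τ) ω σ := by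
  have hp1 : 0 < p - 1 := by linarith
  have hn : (n : ℝ) ≠ 0 := by linarith
  have hm : (m : ℝ) ≠ 0 := by linarith
  have hle : bumpQuantity α β p (τ * τ) ω σ (dilatedCube i (dyadicIndex i z.1))
      (dilatedCube j (dyadicIndex j z.2)) ≤ bumpChar α β p (τ * τ) ω σ := by
    refine le_iSup_of_le _ (le_iSup_of_le _ (le_iSup_of_le (by positivity) (le_iSup_of_le _
      (le_iSup_of_le _ (le_iSup_of_le (by positivity) le_rfl)))))
  refine le_trans ?_ hle
  have es : p * (τ * τ) / (p - 1) = p.conjExponent * τ * τ := by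
    rw [Real.conjExponent]; ring
  have es' : (p - 1) / (p * (τ * τ)) = 1 / (p.conjExponent * τ * τ) := by
    rw [← es, one_div_div]
  have ep : p * (τ * τ) = p * τ * τ := by ring
  rw [bumpQuantity, es', es, ep, setLIntegral_dilatedCube_prod, setLIntegral_dilatedCube_prod]
  change _ ≤ _ * (_ * boxAverage i j (fun w => ω w ^ (p * τ * τ)) z) ^ _
    * (_ * boxAverage i j (fun w => (1 / σ w) ^ (p.conjExponent * τ * τ)) z) ^ _
  have hq0 : 0 < p.conjExponent := by rw [Real.conjExponent]; positivity
  have h1 : 0 ≤ 1 / (p * τ * τ) := by positivity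
  have h2 : 0 ≤ 1 / (p.conjExponent * τ * τ) := by positivity
  rw [ENNReal.mul_rpow_of_nonneg _ _ h1, ENNReal.mul_rpow_of_nonneg _ _ h2]
  set X := boxAverage i j (fun w => ω w ^ (p * τ * τ)) z ^ (1 / (p * τ * τ))
  set Y := boxAverage i j (fun w => (1 / σ w) ^ (p.conjExponent * τ * τ)) z
    ^ (1 / (p.conjExponent * τ * τ))
  set v := volume (dilatedCube i (dyadicIndex i z.1)) with hv
  set w := volume (dilatedCube j (dyadicIndex j z.2)) with hw
  have hv0 : v ≠ 0 := volume_dilatedCube_ne_zero _ _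
  have hvt : v ≠ ∞ := volume_dilatedCube_ne_top _ _
  have hw0 : w ≠ 0 := volume_dilatedCube_ne_zero _ _
  have hwt : w ≠ ∞ := volume_dilatedCube_ne_top _ _
  have hsum : 1 / (p * τ * τ) + 1 / (p.conjExponent * τ * τ) = 1 / (τ * τ) := by
    rw [Real.conjExponent]; field_simp; ring
  have hpow : v ^ (α / n - 1 / (τ * τ)) * w ^ (β / m - 1 / (τ * τ))
      * (v * w) ^ (1 / (p * τ * τ)) * (v * w) ^ (1 / (p.conjExponent * τ * τ))
      = v ^ (α / n) * w ^ (β / m) := by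
    rw [mul_assoc, ← ENNReal.rpow_add _ _ (mul_ne_zero hv0 hw0) (ENNReal.mul_ne_top hvt hwt), hsum,
      ENNReal.mul_rpow_of_nonneg _ _ (by positivity), mul_mul_mul_comm,
      ← ENNReal.rpow_add _ _ hv0 hvt, ← ENNReal.rpow_add _ _ hw0 hwt, sub_add_cancel,
      sub_add_cancel]
  have hside : ∀ {N : ℕ} {γ : ℝ} (l : ℤ), (N : ℝ) ≠ 0 → 0 < γ →
      (2 : ℝ≥0∞) ^ (γ * l) ≤ ((3 * (2 : ℝ≥0∞) ^ (l : ℝ)) ^ N) ^ (γ / N) := fun {N γ} l hN hγ => by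
    rw [← ENNReal.rpow_natCast, ← ENNReal.rpow_mul, mul_div_cancel₀ _ hN, mul_comm γ,
      ENNReal.rpow_mul]
    refine ENNReal.rpow_le_rpow ?_ hγ.le
    exact le_mul_of_one_le_left zero_le (by norm_num)
  calc 2 ^ (α * i + β * j) * (Y * X) ≤ v ^ (α / n) * w ^ (β / m) * (Y * X) := by
        refine mul_le_mul_left ?_ _
        rw [ENNReal.rpow_add _ _ (by simp) (by simp), hv, hw, volume_dilatedCube,
          volume_dilatedCube]
        exact mul_le_mul' (hside i hn hα) (hside j hm hβ)
    _ = _ := by rw [← hpow]; ring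

lemma exists_lintegral_boxPotential_rpow_le {α β p τ : ℝ} (hα : 0 < α) (hαn : α < n) (hβ : 0 < β)
    (hβm : β < m) (hp : 1 < p) (hτ : 1 < τ) :
    ∃ K : ℝ≥0∞, K ≠ ∞ ∧
      ∀ {ω σ F : EuclideanSpace ℝ (Fin n) × EuclideanSpace ℝ (Fin m) → ℝ≥0∞},
      Measurable ω → Measurable σ → Measurable F → bumpChar α β p (τ * τ) ω σ ≠ ∞ →
      (∫⁻ z, (ω z * boxPotential α β (fun w => F w * (1 / σ w)) z) ^ p) ^ (1 / p)
        ≤ K * bumpChar α β p (τ * τ) ω σ * (∫⁻ z, F z ^ p) ^ (1 / p) := by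
  have hpq := Real.HolderConjugate.conjExponent hp
  obtain ⟨K, hK, h⟩ := exists_tsum_lintegral_boxAverage_le n m hα hβ hpq hτ
  refine ⟨K, hK, fun {ω σ F} hω hσ hF hA => ?_⟩
  refine lintegral_rpow_le_of_forall_lintegral_mul_le hpq
    (hω.mul (measurable_boxPotential _ _ _)) fun G hG => ?_
  have hU : Measurable fun w => 1 / σ w := hσ.const_div _
  have := h hA hU hω hF hG
    (fun i j z => two_rpow_mul_boxAverage_le_bumpChar hα hαn hβ hβm hp hτ ω σ i j z)
  rw [← mul_assoc] at this
  refine le_trans (le_of_eq ?_) this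
  rw [← lintegral_tsum]
  · refine lintegral_congr fun z => ?_
    simp only [ENNReal.tsum_mul_left, boxPotential, Pi.mul_apply, mul_assoc]
  · exact fun r => ((hG.mul hω).mul ((measurable_boxAverage _ _ _).const_mul _)).aemeasurable

/-! ### Degenerate weights and passage to measurable representatives -/

lemma bumpChar_congr_ae {α β p ϑ : ℝ}
    {ω ω' σ σ' : EuclideanSpace ℝ (Fin n) × EuclideanSpace ℝ (Fin m) → ℝ≥0∞}
    (hω : ω =ᵐ[volume] ω') (hσ : σ =ᵐ[volume] σ') :
    bumpChar α β p ϑ ω σ = bumpChar α β p ϑ ω' σ' := by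
  have h : ∀ Q P, bumpQuantity α β p ϑ ω σ Q P = bumpQuantity α β p ϑ ω' σ' Q P := fun Q P => by
    rw [bumpQuantity, bumpQuantity]
    congr 2
    · congr 1
      refine lintegral_congr_ae (ae_restrict_of_ae ?_)
      filter_upwards [hω] with z hz
      rw [hz]
    · refine lintegral_congr_ae (ae_restrict_of_ae ?_)
      filter_upwards [hσ] with z hz
      rw [hz]
  simp only [bumpChar, h]

/-- If the characteristic is finite then `σ` vanishes only on a null set, unless `ω` vanishes almost
everywhere: on a large box the second integral would be infinite and the first one positive. -/
lemma ae_eq_zero_or_ae_ne_zero_of_bumpChar_ne_top {α β p ϑ : ℝ} (hp : 1 < p) (hϑ : 1 < ϑ)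
    {ω σ : EuclideanSpace ℝ (Fin n) × EuclideanSpace ℝ (Fin m) → ℝ≥0∞}
    (hω : Measurable ω) (hσ : Measurable σ) (hA : bumpChar α β p ϑ ω σ ≠ ∞) :
    (∀ᵐ z, ω z = 0) ∨ ∀ᵐ z, σ z ≠ 0 := by
  by_contra hcon
  obtain ⟨h1, h2⟩ := not_or.mp hcon
  rw [ae_iff] at h1 h2
  let Q : ∀ N : ℕ, ℕ → Set (EuclideanSpace ℝ (Fin N)) := fun N M =>
    cube (WithLp.toLp 2 fun _ => -((M : ℝ) + 1)) (2 * ((M : ℝ) + 1))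
  have hQmem : ∀ {N M : ℕ} {x : EuclideanSpace ℝ (Fin N)}, ‖x‖ ≤ M → x ∈ Q N M := by
    intro N M x hx l
    have := (PiLp.norm_apply_le x l).trans hx
    rw [Real.norm_eq_abs, abs_le] at this
    simp only
    constructor <;> linarith [this.1, this.2]
  have hcover : ∀ S : Set (EuclideanSpace ℝ (Fin n) × EuclideanSpace ℝ (Fin m)), volume S ≠ 0 →
      ∃ M₀, ∀ M ≥ M₀, volume (S ∩ Q n M ×ˢ Q m M) ≠ 0 := by
    intro S hS
    have : ∃ M₀ : ℕ, volume (S ∩ {z | ‖z‖ ≤ M₀}) ≠ 0 := by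
      by_contra! hc
      refine hS (measure_mono_null (fun z hz => ?_) (measure_iUnion_null hc))
      obtain ⟨M, hM⟩ := exists_nat_ge ‖z‖
      exact Set.mem_iUnion.mpr ⟨M, hz, hM⟩
    obtain ⟨M₀, hM₀⟩ := this
    refine ⟨M₀, fun M hM hc => hM₀ (measure_mono_null (Set.inter_subset_inter_right _ ?_) hc)⟩
    intro z hz
    have hzM : ‖z‖ ≤ M := (Set.mem_ofPred_eq.mp hz).trans (by exact_mod_cast hM)
    exact ⟨hQmem ((norm_fst_le z).trans hzM), hQmem ((norm_snd_le z).trans hzM)⟩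
  obtain ⟨M₁, hM₁⟩ := hcover {z | ¬ ω z = 0} h1
  obtain ⟨M₂, hM₂⟩ := hcover {z | ¬ σ z ≠ 0} h2
  set M := max M₁ M₂
  have hm₁ := hM₁ M (le_max_left _ _)
  have hm₂ := hM₂ M (le_max_right _ _)
  have hpos : (0 : ℝ) < 2 * ((M : ℝ) + 1) := by positivity
  have hvol : ∀ {N : ℕ}, volume (Q N M) ≠ 0 ∧ volume (Q N M) ≠ ∞ := fun {N} => by
    rw [volume_cube]
    exact ⟨pow_ne_zero _ (by simpa using hpos), by finiteness⟩
  have hR : MeasurableSet (Q n M ×ˢ Q m M) := (measurableSet_cube _ _).prod (measurableSet_cube _ _)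
  have hX : ∫⁻ z in Q n M ×ˢ Q m M, ω z ^ (p * ϑ) ≠ 0 := by
    intro h0
    rw [lintegral_eq_zero_iff (hω.pow_const _)] at h0
    refine hm₁ ?_
    have h3 : ∀ᵐ z ∂volume.restrict (Q n M ×ˢ Q m M), ω z = 0 := by
      filter_upwards [h0] with z hz
      have hpϑ : 0 < p * ϑ := by nlinarith
      exact (ENNReal.rpow_eq_zero_iff_of_pos hpϑ).mp hz
    rw [ae_iff, Measure.restrict_apply' hR] at h3
    exact h3
  have hexp : 0 < p * ϑ / (p - 1) := div_pos (by nlinarith) (by linarith)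
  have hY : ∫⁻ z in Q n M ×ˢ Q m M, (1 / σ z) ^ (p * ϑ / (p - 1)) = ∞ := by
    by_contra hne
    have h3 := ae_lt_top ((hσ.const_div 1).pow_const (p * ϑ / (p - 1))) hne
    refine hm₂ ?_
    have h4 : ∀ᵐ z ∂volume.restrict (Q n M ×ˢ Q m M), σ z ≠ 0 := by
      filter_upwards [h3] with z hz hz0
      rw [hz0] at hz
      simp [hexp] at hz
    rw [ae_iff, Measure.restrict_apply' hR] at h4
    exact h4
  refine hA (top_le_iff.mp ?_)
  have hle : bumpQuantity α β p ϑ ω σ (Q n M) (Q m M) ≤ bumpChar α β p ϑ ω σ :=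
    le_iSup_of_le _ (le_iSup_of_le _ (le_iSup_of_le hpos (le_iSup_of_le _
      (le_iSup_of_le _ (le_iSup_of_le hpos le_rfl)))))
  refine le_trans (le_of_eq ?_) hle
  rw [bumpQuantity, hY, ENNReal.top_rpow_of_pos (div_pos (by linarith) (by nlinarith)),
    ENNReal.mul_top]
  have hrp : ∀ {N : ℕ} (t : ℝ), volume (Q N M) ^ t ≠ 0 := fun {N} t => by
    simp [ENNReal.rpow_eq_zero_iff, hvol (N := N)]
  refine mul_ne_zero (mul_ne_zero (hrp _) (hrp _)) ?_
  rw [ne_eq, ENNReal.rpow_eq_zero_iff_of_pos (by apply one_div_pos.mpr; nlinarith)]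
  exact hX

end Operator

/-! ### The kernel and the norm -/

section Kernel

variable {n m : ℕ}

lemma measurable_strongKernel (α β : ℝ)
    (z : EuclideanSpace ℝ (Fin n) × EuclideanSpace ℝ (Fin m)) :
    Measurable (strongKernel α β z) := by
  unfold strongKernel
  fun_prop

lemma strongKernel_nonneg (α β : ℝ)
    (z w : EuclideanSpace ℝ (Fin n) × EuclideanSpace ℝ (Fin m)) : 0 ≤ strongKernel α β z w := by
  unfold strongKernel
  positivity

lemma enorm_strongFracIntegrand (α β : ℝ)
    (f : EuclideanSpace ℝ (Fin n) × EuclideanSpace ℝ (Fin m) → ℂ)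
    (z w : EuclideanSpace ℝ (Fin n) × EuclideanSpace ℝ (Fin m)) :
    ‖strongFracIntegrand α β f z w‖ₑ = ‖f w‖ₑ * ENNReal.ofReal (strongKernel α β z w) := by
  rw [strongFracIntegrand, enorm_mul]
  congr 1
  rw [← ofReal_norm, Complex.norm_real, Real.norm_of_nonneg (strongKernel_nonneg α β z w)]

lemma eLpNorm_ofReal_eq {Ω : Type*} [MeasurableSpace Ω] {μ : Measure Ω} {p : ℝ} (hp : 0 < p)
    (H : Ω → ℝ≥0∞) :
    eLpNorm H (ENNReal.ofReal p) μ = (∫⁻ z, H z ^ p ∂μ) ^ (1 / p) := by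
  rw [eLpNorm_eq_lintegral_rpow_enorm_toReal (by simpa using hp) (by simp),
    ENNReal.toReal_ofReal hp.le]
  simp

end Kernel

theorem mainTheorem1 (n m : ℕ) (α β p ϑ : ℝ)
    (hα : 0 < α) (hαn : α < n) (hβ : 0 < β) (hβm : β < m) (hp : 1 < p) (hϑ : 1 < ϑ) :
    ∃ C : ℝ, 0 < C ∧
      ∀ (ω σ : EuclideanSpace ℝ (Fin n) × EuclideanSpace ℝ (Fin m) → ℝ≥0∞),
        AEMeasurable ω → AEMeasurable σ → bumpChar α β p ϑ ω σ < ∞ →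
        ∀ f : EuclideanSpace ℝ (Fin n) × EuclideanSpace ℝ (Fin m) → ℂ,
          AEStronglyMeasurable f →
          eLpNorm (fun z => ‖f z‖ₑ * σ z) (ENNReal.ofReal p) volume < ∞ →
          (∀ᵐ z, ω z ≠ 0 → Integrable (strongFracIntegrand α β f z)) ∧
          eLpNorm (fun z => ω z * ‖strongFracIntegral α β f z‖ₑ) (ENNReal.ofReal p) volume
            ≤ ENNReal.ofReal C * bumpChar α β p ϑ ω σ
              * eLpNorm (fun z => ‖f z‖ₑ * σ z) (ENNReal.ofReal p) volume := by
  have hp0 : 0 < p := by linarith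
  -- the bump `ϑ = τ * τ` is spent in two equal parts
  obtain ⟨τ, hτ, rfl⟩ : ∃ τ : ℝ, 1 < τ ∧ ϑ = τ * τ :=
    ⟨√ϑ, Real.lt_sqrt_of_sq_lt (by simpa using hϑ), (Real.mul_self_sqrt (by linarith)).symm⟩
  obtain ⟨K, hK, hmain⟩ :=
    exists_lintegral_boxPotential_rpow_le (n := n) (m := m) hα hαn hβ hβm hp hτ
  set K₀ : ℝ≥0∞ := 2 ^ (n - α) * 2 ^ (m - β) * (3 ^ n * 3 ^ m) with hK₀def
  have hK₀ : K₀ ≠ ∞ := by finiteness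
  have hKK : K₀ * K ≠ ∞ := ENNReal.mul_ne_top hK₀ hK
  refine ⟨(K₀ * K).toReal + 1, by positivity, fun ω σ hω hσ hA f hf hF => ?_⟩
  have hKC : K₀ * K ≤ ENNReal.ofReal ((K₀ * K).toReal + 1) := by
    rw [← ENNReal.ofReal_toReal hKK]
    exact ENNReal.ofReal_le_ofReal (by simp)
  set ω' := hω.mk ω with hω'
  set σ' := hσ.mk σ with hσ'
  have hωm : Measurable ω' := hω.measurable_mk
  have hσm : Measurable σ' := hσ.measurable_mk
  have hωe : ω =ᵐ[volume] ω' := hω.ae_eq_mk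
  have hσe : σ =ᵐ[volume] σ' := hσ.ae_eq_mk
  rw [bumpChar_congr_ae hωe hσe] at hA ⊢
  rcases ae_eq_zero_or_ae_ne_zero_of_bumpChar_ne_top hp hϑ hωm hσm hA.ne with h0 | hσ0
  · have hω0 : ∀ᵐ z, ω z = 0 := by
      filter_upwards [hωe, h0] with z h1 h2
      rw [h1, h2]
    refine ⟨by filter_upwards [hω0] with z hz hz'; exact absurd hz hz', ?_⟩
    rw [eLpNorm_ofReal_eq hp0, lintegral_congr_ae (g := fun _ => 0)]
    · simp [hp0]
    · filter_upwards [hω0] with z hz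
      simp [hz, hp0]
  have hFm : AEMeasurable fun z => ‖f z‖ₑ * σ z := hf.enorm.mul hσ
  set F := hFm.mk _ with hFdef
  have hFmeas : Measurable F := hFm.measurable_mk
  have hFe : (fun z => ‖f z‖ₑ * σ z) =ᵐ[volume] F := hFm.ae_eq_mk
  have hFnorm : eLpNorm (fun z => ‖f z‖ₑ * σ z) (ENNReal.ofReal p) volume
      = (∫⁻ z, F z ^ p) ^ (1 / p) := by
    rw [eLpNorm_ofReal_eq hp0, lintegral_congr_ae]
    filter_upwards [hFe] with z hz
    rw [hz]
  rw [hFnorm] at hF ⊢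
  have hFfin : ∀ᵐ z, F z < ∞ := by
    have h1 : ∫⁻ z, F z ^ p ≠ ∞ := by
      intro h
      rw [h, ENNReal.top_rpow_of_pos (by positivity)] at hF
      exact lt_irrefl _ hF
    filter_upwards [ae_lt_top (hFmeas.pow_const p) h1] with z hz
    by_contra hcon
    rw [not_lt, top_le_iff] at hcon
    simp [hcon, hp0] at hz
  -- where `σ = ∞`, the function `f` vanishes almost everywhere, as `f * σ` is finite there
  have hfF : ∀ᵐ w, ‖f w‖ₑ ≤ F w * (1 / σ' w) := by
    filter_upwards [hFe, hσe, hσ0, hFfin] with w h1 h2 h3 h4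
    simp only [← h1, h2] at h4 ⊢
    rcases eq_or_ne (σ' w) ∞ with h5 | h5
    · rw [h5] at h4
      have : ‖f w‖ₑ = 0 := by
        by_contra hne
        rw [ENNReal.mul_top hne] at h4
        exact lt_irrefl _ h4
      rw [this]; exact zero_le
    · rw [mul_assoc, one_div, ENNReal.mul_inv_cancel h3 h5, mul_one]
  set P := boxPotential α β (fun w => F w * (1 / σ' w)) with hP
  have hPm : Measurable P := measurable_boxPotential _ _ _
  have hint : ∀ z, ∫⁻ w, ‖strongFracIntegrand α β f z w‖ₑ ≤ K₀ * P z := fun z => by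
    refine le_trans (lintegral_mono_ae ?_) (lintegral_mul_strongKernel_le hαn hβm
      (hFmeas.mul (hσm.const_div 1)) z)
    filter_upwards [hfF] with w hw
    rw [enorm_strongFracIntegrand]
    exact mul_le_mul_left hw _
  have hbound := hmain hωm hσm hFmeas hA.ne
  rw [← hP] at hbound
  constructor
  · have hfin : ∫⁻ z, (ω' z * P z) ^ p ≠ ∞ := by
      intro h
      rw [h, ENNReal.top_rpow_of_pos (by positivity), top_le_iff] at hbound
      exact ENNReal.mul_ne_top (ENNReal.mul_ne_top hK hA.ne) hF.ne hbound
    filter_upwards [ae_lt_top ((hωm.mul hPm).pow_const p) hfin, hωe] with z hz hze hne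
    rw [hze] at hne
    refine ⟨hf.mul ((Complex.measurable_ofReal.comp
      (measurable_strongKernel α β z)).aestronglyMeasurable), ?_⟩
    refine (hint z).trans_lt (ENNReal.mul_lt_top hK₀.lt_top ?_)
    by_contra hcon
    rw [not_lt, top_le_iff] at hcon
    simp [hcon, ENNReal.mul_top hne, hp0] at hz
  · rw [eLpNorm_ofReal_eq hp0]
    calc (∫⁻ z, (ω z * ‖strongFracIntegral α β f z‖ₑ) ^ p) ^ (1 / p)
        ≤ (∫⁻ z, (K₀ * (ω' z * P z)) ^ p) ^ (1 / p) := by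
          refine ENNReal.rpow_le_rpow (lintegral_mono_ae ?_) (by positivity)
          filter_upwards [hωe] with z hz
          refine ENNReal.rpow_le_rpow ?_ hp0.le
          rw [hz, mul_left_comm]
          exact mul_le_mul_right ((enorm_integral_le_lintegral_enorm _).trans (hint z)) _
      _ = K₀ * (∫⁻ z, (ω' z * P z) ^ p) ^ (1 / p) := by
          simp only [fun z => ENNReal.mul_rpow_of_nonneg K₀ (ω' z * P z) hp0.le]
          rw [lintegral_const_mul' _ _ (by finiteness),
            ENNReal.mul_rpow_of_nonneg _ _ (by positivity), ← ENNReal.rpow_mul,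
            mul_one_div_cancel hp0.ne', ENNReal.rpow_one]
      _ ≤ K₀ * (K * bumpChar α β p (τ * τ) ω' σ' * (∫⁻ z, F z ^ p) ^ (1 / p)) :=
          mul_le_mul_right hbound _
      _ = K₀ * K * bumpChar α β p (τ * τ) ω' σ' * (∫⁻ z, F z ^ p) ^ (1 / p) := by ring
      _ ≤ _ := by gcongr
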